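/- **Setting.** Let $X$ and $Y$ be connected Hausdorff $C^1$ manifolds modelled on real Banach spaces $(E,|\cdot|_E)$ and $(F,|\cdot|_F)$. A chart $(W,\varphi)$ at a point is a $C^1$-compatible chart whose (open) domain $W$ contains the point. A *Finsler structure* on $X$ is a continuous map $\|\cdot\|:TX\to[0,\infty)$ such that each restriction $\|\cdot\|_x$ to $T_xX$ is a norm and: (1) for every $x$ and every chart $(W,\varphi)$ at $x$, $\|d\varphi^{-1}(\varphi(x))(\cdot)\|_x$ is a norm on $E$ equivalent to $|\cdot|_E$; (2) for every $x_0$, every chart $(W,\varphi)$ at $x_0$ and every $\varepsilon>0$ there is an open neighbourhood $U\subset W$ of $x_0$ with $$\tfrac1{1+\varepsilon}\|d\varphi^{-1}(\varphi(x_0))\mathbf v\|_{x_0}\le\|d\varphi^{-1}(\varphi(x))\mathbf v\|_x\le(1+\varepsilon)\|d\varphi^{-1}(\varphi(x_0))\mathbf v\|_{x_0}\qquad(x\in U,\ \mathbf v\in E).$$ The distance $d_X(u,u')$ is the infimum of the lengths $\int\|\dot\sigma(t)\|_{\sigma(t)}\,dt$ of $C^1$ paths $\sigma$ from $u$ to $u'$,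 and $B_X(x;r)$ is the open ball for $d_X$. The same notation is used for $Y$. Let $X$ and $Y$ carry Finsler structures, where $Y$ *has smooth norm*: for each $y\in Y$ the norm $\|\cdot\|_y$ is Fréchet differentiable on $T_yY\setminus\{0\}$. Let $f:X\to Y$ be *locally Lipschitz*: for each $x\in X$ there are charts $(W,\varphi)$ at $x$ and $(V,\psi)$ at $f(x)$ with $f(W)\subset V$ such that $\mathbf f=\psi\circ f\circ\varphi^{-1}:\varphi(W)\to\psi(V)$ is Lipschitz. A nonempty set $A\subset\mathcal L(E,F)$ is a *pseudo-Jacobian* of a map $\mathbf f$ into $F$, defined near $\mathbf u\in E$, at $\mathbf u$ if $$\limsup_{t\to0^+}\frac{\langle y^*,\mathbf f(\mathbf u+tv)\rangle-\langle y^*,\mathbf f(\mathbf u)\rangle}{t}\le\sup_{T\in A}\langle y^*,Tv\rangle\qquad\text{for all }y^*\in F^*,\ v\in E.$$ Suppose that for each $x\in X$ a set $Jf(x)\subset\mathcal L(T_xX,T_{f(x)}Y)$ is given and that $Jf$ is a *strong pseudo-Jacobian mapping* for $f$: for each $x\in X$ there are charts $(W,\varphi)$ at $x$ and $(V,\psi)$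 at $f(x)$ with $f(W)\subset V$, and sets $J\mathbf f(\mathbf u)\subset\mathcal L(E,F)$, $\mathbf u\in\varphi(W)$, such that - each $J\mathbf f(\mathbf u)$ is a pseudo-Jacobian of $\mathbf f=\psi\circ f\circ\varphi^{-1}$ at $\mathbf u$; - $J\mathbf f$ is locally bounded: each $\mathbf u\in\varphi(W)$ is the centre of a ball $B\subset\varphi(W)$ such that $\bigcup_{\mathbf z\in B}J\mathbf f(\mathbf z)$ is bounded in operator norm; - $Jf(x)=\{d\psi^{-1}(\psi(f(x)))\circ\mathbf T\circ[d\varphi^{-1}(\varphi(x))]^{-1}:\mathbf T\in J\mathbf f(\varphi(x))\}$; - each $J\mathbf f(\mathbf u)$ is convex and compact in the weak operator topology. For $T\in\mathcal L(T_xX,T_{f(x)}Y)$ put $C_{\rm Finsler}(T)=\inf\{|T^*y^*|_x:\ y^*\in(T_{f(x)}Y)^*,\ |y^*|_{f(x)}=1\}$, with the norms dual to $\|\cdot\|_x$ and $\|\cdot\|_{f(x)}$ and $\inf\emptyset=+\infty$. Given charts $(W,\varphi)$ at $x$ and $(V,\psi)$ at $f(x)$ with $f(W)\subset V$, the *Finsler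 regularity index* is $$C(Jf(x))=\sup_{R>0}\ \inf\{C_{\rm Finsler}(T):\ T\in\operatorname{co}Jf(B_X(x;R))\},$$ where $Jf(B_X(x;R))$ is the union over $u\in B_X(x;R)\cap W$ of the sets $Jf(u)$, with $S\in\mathcal L(T_uX,T_{f(u)}Y)$ regarded as the operator in $\mathcal L(T_xX,T_{f(x)}Y)$ that has the same representation $d\psi(f(u))\circ S\circ d\varphi^{-1}(\varphi(u))\in\mathcal L(E,F)$ in the charts. The *rate of surjection* $\operatorname{cov}f(x)\in[0,\infty]$ is the supremum of all $\alpha>0$ for which there is a neighbourhood $W_x$ of $x$ such that $B_Y(f(u);\alpha r)\subset f(B_X(u;r))$ for all $u\in W_x$ and $r>0$ with $B_X(u;r)\subset W_x$ (and $0$ if there is no such $\alpha$). **Theorem.** Under these assumptions, for every $x\in X$ and whichever charts $(W,\varphi)$ at $x$ and $(V,\psi)$ at $f(x)$ with $f(W)\subset V$ are used to compute the index, $$\operatorname{cov}f(x)\ \ge\ C(Jf(x)).$$ -/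

import Mathlib

open Set Filter Topology Manifold
open scoped ENNReal NNReal ContDiff

noncomputable section FinslerDefs

/-! ### Pseudo-Jacobians between Banach spaces -/

section Banach

variable {E : Type*} [NormedAddCommGroup E] [NormedSpace ℝ E]
  {F : Type*} [NormedAddCommGroup F] [NormedSpace ℝ F]

/-- The upper right-hand Dini derivative `g'₊(x; v) = limsup_{t → 0⁺} (g (x + t v) - g x) / t`,
as an extended real number. -/
def upperDini (g : E → ℝ) (x v : E) : EReal :=
  limsup (fun t : ℝ => (((g (x + t • v) - g x) / t : ℝ) : EReal)) (𝓝[>] (0 : ℝ))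

/-- The set `A` of bounded operators is a pseudo-Jacobian of `g` at `x` (only the germ of `g` at `x`
matters): `A` is nonempty and
`(y* ∘ g)'₊(x; v) ≤ sup {⟨y*, T v⟩ : T ∈ A}` for all `y* ∈ F*` and `v ∈ E`. -/
def IsPseudoJacobianAt (g : E → F) (A : Set (E →L[ℝ] F)) (x : E) : Prop :=
  A.Nonempty ∧ ∀ (y' : StrongDual ℝ F) (v : E),
    upperDini (fun z => y' (g z)) x v ≤ ⨆ T ∈ A, ((y' (T v) : ℝ) : EReal)

/-- A set-valued mapping defined on `U` is locally bounded on `U`. -/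
def LocallyBoundedOn (JJ : E → Set (E →L[ℝ] F)) (U : Set E) : Prop :=
  ∀ x ∈ U, ∃ R > 0, Metric.ball x R ⊆ U ∧ Bornology.IsBounded (⋃ z ∈ Metric.ball x R, JJ z)

/-- Compactness of a set of bounded operators in the weak operator topology. -/
def IsWOTCompact (A : Set (E →L[ℝ] F)) : Prop :=
  IsCompact ((fun T : E →L[ℝ] F => (ContinuousLinearMapWOT.ofCLM T : E →WOT[ℝ] F)) '' A)

end Banach

/-! ### Charts of a `C^1` manifold modelled on a Banach space -/

section Charts

variable {E : Type*} [NormedAddCommGroup E] [NormedSpace ℝ E]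
  {X : Type*} [TopologicalSpace X] [ChartedSpace E X]

/-- `φ` is a `C^1` chart of `X` at `x`; its domain is `φ.source`. -/
def IsChartAt (φ : OpenPartialHomeomorph X E) (x : X) : Prop :=
  φ ∈ IsManifold.maximalAtlas 𝓘(ℝ, E) 1 X ∧ x ∈ φ.source

/-- `dφ(x) : T_x X → E`. -/
def chartDeriv (φ : OpenPartialHomeomorph X E) (x : X) : TangentSpace 𝓘(ℝ, E) x →L[ℝ] E :=
  mfderiv 𝓘(ℝ, E) 𝓘(ℝ, E) φ x

/-- `dφ⁻¹(φ(x)) : E → T_x X` (for `x` in the domain of `φ`). -/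
def chartDerivSymm (φ : OpenPartialHomeomorph X E) (x : X) : E →L[ℝ] TangentSpace 𝓘(ℝ, E) x :=
  mfderiv 𝓘(ℝ, E) 𝓘(ℝ, E) φ.symm (φ x)

end Charts

/-! ### Finsler structures -/

/-- A Finsler structure on (the tangent bundle of) a `C^1` manifold `X` modelled on `E`.  Each
`toSeminorm x` is a norm on `T_x X`: definiteness follows from `equivalent`. -/
structure FinslerStructure (E : Type*) [NormedAddCommGroup E] [NormedSpace ℝ E]
    (X : Type*) [TopologicalSpace X] [ChartedSpace E X] [IsManifold 𝓘(ℝ, E) 1 X] where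
  /-- The norm on each tangent space. -/
  toSeminorm : ∀ x : X, Seminorm ℝ (TangentSpace 𝓘(ℝ, E) x)
  /-- Continuity on the tangent bundle. -/
  continuous_norm : Continuous fun p : TangentBundle 𝓘(ℝ, E) X => toSeminorm p.1 p.2
  /-- In each chart, the norm is equivalent to the norm of the model space. -/
  equivalent : ∀ (x : X) (φ : OpenPartialHomeomorph X E), IsChartAt φ x →
    ∃ c > 0, ∃ C > 0, ∀ v : E, c * ‖v‖ ≤ toSeminorm x (chartDerivSymm φ x v) ∧
      toSeminorm x (chartDerivSymm φ x v) ≤ C * ‖v‖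
  /-- Local comparison of the norms at nearby points, in each chart. -/
  locally_comparable : ∀ (x₀ : X) (φ : OpenPartialHomeomorph X E), IsChartAt φ x₀ →
    ∀ ε : ℝ, 0 < ε → ∃ U : Set X, IsOpen U ∧ x₀ ∈ U ∧ U ⊆ φ.source ∧ ∀ x ∈ U, ∀ v : E,
      (1 / (1 + ε)) * toSeminorm x₀ (chartDerivSymm φ x₀ v) ≤
          toSeminorm x (chartDerivSymm φ x v) ∧
        toSeminorm x (chartDerivSymm φ x v) ≤
          (1 + ε) * toSeminorm x₀ (chartDerivSymm φ x₀ v)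

namespace FinslerStructure

variable {E : Type*} [NormedAddCommGroup E] [NormedSpace ℝ E]
  {X : Type*} [TopologicalSpace X] [ChartedSpace E X] [IsManifold 𝓘(ℝ, E) 1 X]

/-- The Finsler distance: the infimum of the lengths `∫ ‖σ'(t)‖_{σ(t)} dt` of the `C^1` paths `σ`
from `x` to `y` (Mathlib's `riemannianEDist` only uses the norms on the tangent spaces).
It is finite on connected manifolds. -/
def edist (N : FinslerStructure E X) (x y : X) : ℝ≥0∞ :=
  letI : ∀ z : X, ENorm (TangentSpace 𝓘(ℝ, E) z) :=
    fun z => ⟨fun v => ENNReal.ofReal (N.toSeminorm z v)⟩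
  riemannianEDist 𝓘(ℝ, E) x y

/-- The open ball `B_X(x; r)` for the Finsler distance. -/
def ball (N : FinslerStructure E X) (x : X) (r : ℝ) : Set X :=
  {z | N.edist z x < ENNReal.ofReal r}

/-- The norm on the dual of `T_x X`, dual to the Finsler norm on `T_x X`. -/
def dualNorm (N : FinslerStructure E X) (x : X)
    (l : TangentSpace 𝓘(ℝ, E) x →L[ℝ] ℝ) : ℝ≥0∞ :=
  ⨆ v : {v : TangentSpace 𝓘(ℝ, E) x // N.toSeminorm x v ≤ 1}, ENNReal.ofReal |l v|

/-- Every norm `‖·‖_x` is Fréchet differentiable away from `0`. -/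
def HasSmoothNorm (N : FinslerStructure E X) : Prop :=
  ∀ (x : X) (v : TangentSpace 𝓘(ℝ, E) x), v ≠ 0 →
    DifferentiableAt ℝ (fun w : TangentSpace 𝓘(ℝ, E) x => N.toSeminorm x w) v

end FinslerStructure

/-! ### Maps between manifolds -/

section Maps

variable {E : Type*} [NormedAddCommGroup E] [NormedSpace ℝ E]
  {F : Type*} [NormedAddCommGroup F] [NormedSpace ℝ F]
  {X : Type*} [TopologicalSpace X] [ChartedSpace E X]
  {Y : Type*} [TopologicalSpace Y] [ChartedSpace F Y]

/-- `φ` is a chart at `x` with domain `W`, `ψ` is a chart at `f x` with domain `V`, and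
`f(W) ⊆ V`. -/
structure IsChartPair (f : X → Y) (x : X) (φ : OpenPartialHomeomorph X E)
    (ψ : OpenPartialHomeomorph Y F) : Prop where
  source : IsChartAt φ x
  target : IsChartAt ψ (f x)
  mapsTo : MapsTo f φ.source ψ.source

/-- The map `ψ ∘ f ∘ φ⁻¹`, to be considered on `φ(W) = φ.target`. -/
def inCharts (f : X → Y) (φ : OpenPartialHomeomorph X E) (ψ : OpenPartialHomeomorph Y F) : E → F :=
  fun u => ψ (f (φ.symm u))

/-- Local Lipschitz continuity of a map between `C^1` Banach manifolds, through charts. -/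
def IsLocallyLipschitz (E : Type*) [NormedAddCommGroup E] [NormedSpace ℝ E]
    (F : Type*) [NormedAddCommGroup F] [NormedSpace ℝ F]
    {X : Type*} [TopologicalSpace X] [ChartedSpace E X]
    {Y : Type*} [TopologicalSpace Y] [ChartedSpace F Y] (f : X → Y) : Prop :=
  ∀ x : X, ∃ (φ : OpenPartialHomeomorph X E) (ψ : OpenPartialHomeomorph Y F),
    IsChartPair f x φ ψ ∧ ∃ K : ℝ≥0, LipschitzOnWith K (inCharts f φ ψ) φ.target

/-- `JJ` is a locally bounded pseudo-Jacobian mapping of `ψ ∘ f ∘ φ⁻¹` on `φ(W)`, which at the point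
`φ(x)` represents the set `A` of operators from `T_x X` to `T_{f x} Y`. -/
structure IsChartPseudoJacobian (f : X → Y) (x : X)
    (A : Set (TangentSpace 𝓘(ℝ, E) x →L[ℝ] TangentSpace 𝓘(ℝ, F) (f x)))
    (φ : OpenPartialHomeomorph X E) (ψ : OpenPartialHomeomorph Y F)
    (JJ : E → Set (E →L[ℝ] F)) : Prop where
  chartPair : IsChartPair f x φ ψ
  pseudoJacobian : ∀ u ∈ φ.target, IsPseudoJacobianAt (inCharts f φ ψ) (JJ u) u
  locallyBounded : LocallyBoundedOn JJ φ.target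
  represents : A = (fun T : E →L[ℝ] F =>
    (chartDerivSymm ψ (f x)).comp (T.comp (chartDeriv φ x))) '' JJ (φ x)

/-- `J` is a pseudo-Jacobian mapping for `f`. -/
def IsPseudoJacobianMapping (f : X → Y)
    (J : ∀ x : X, Set (TangentSpace 𝓘(ℝ, E) x →L[ℝ] TangentSpace 𝓘(ℝ, F) (f x))) : Prop :=
  ∀ x : X, ∃ (φ : OpenPartialHomeomorph X E) (ψ : OpenPartialHomeomorph Y F)
    (JJ : E → Set (E →L[ℝ] F)), IsChartPseudoJacobian f x (J x) φ ψ JJ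

/-- `J` is a strong pseudo-Jacobian mapping for `f`: the sets of operators in the charts are, in
addition, convex and compact in the weak operator topology. -/
def IsStrongPseudoJacobianMapping (f : X → Y)
    (J : ∀ x : X, Set (TangentSpace 𝓘(ℝ, E) x →L[ℝ] TangentSpace 𝓘(ℝ, F) (f x))) : Prop :=
  ∀ x : X, ∃ (φ : OpenPartialHomeomorph X E) (ψ : OpenPartialHomeomorph Y F)
    (JJ : E → Set (E →L[ℝ] F)), IsChartPseudoJacobian f x (J x) φ ψ JJ ∧
      ∀ u ∈ φ.target, Convex ℝ (JJ u) ∧ IsWOTCompact (JJ u)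

/-- The operator from `T_x X` to `T_{f x} Y` which has in the charts `φ`, `ψ` the same
representation `dψ(f u) ∘ T ∘ dφ⁻¹(φ u) : E → F` as the operator `T` from `T_u X` to `T_{f u} Y`. -/
def transport (f : X → Y) (φ : OpenPartialHomeomorph X E) (ψ : OpenPartialHomeomorph Y F) (x u : X)
    (T : TangentSpace 𝓘(ℝ, E) u →L[ℝ] TangentSpace 𝓘(ℝ, F) (f u)) :
    TangentSpace 𝓘(ℝ, E) x →L[ℝ] TangentSpace 𝓘(ℝ, F) (f x) :=
  (chartDerivSymm ψ (f x)).comp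
    (((chartDeriv ψ (f u)).comp (T.comp (chartDerivSymm φ u))).comp (chartDeriv φ x))

variable [IsManifold 𝓘(ℝ, E) 1 X] [IsManifold 𝓘(ℝ, F) 1 Y]

/-- The Banach constant `inf {|T* y*|_x : y* ∈ (T_y Y)*, |y*|_y = 1}` of an operator
`T : T_x X → T_y Y`, for the norms dual to the Finsler norms. -/
def banachConstant (NX : FinslerStructure E X) (NY : FinslerStructure F Y) (x : X) (y : Y)
    (T : TangentSpace 𝓘(ℝ, E) x →L[ℝ] TangentSpace 𝓘(ℝ, F) y) : ℝ≥0∞ :=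
  ⨅ y' : {y' : TangentSpace 𝓘(ℝ, F) y →L[ℝ] ℝ // NY.dualNorm y y' = 1},
    NX.dualNorm x (y'.1.comp T)

/-- The set `Jf(B_X(x; R))`.  Operators between the tangent spaces at different points are regarded
as operators from `T_x X` to `T_{f x} Y` by means of the charts `φ`, `ψ`. -/
def jacobianOnBall (NX : FinslerStructure E X) (f : X → Y)
    (J : ∀ x : X, Set (TangentSpace 𝓘(ℝ, E) x →L[ℝ] TangentSpace 𝓘(ℝ, F) (f x)))
    (φ : OpenPartialHomeomorph X E) (ψ : OpenPartialHomeomorph Y F) (x : X) (R : ℝ) :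
    Set (TangentSpace 𝓘(ℝ, E) x →L[ℝ] TangentSpace 𝓘(ℝ, F) (f x)) :=
  ⋃ u ∈ NX.ball x R ∩ φ.source, transport f φ ψ x u '' J u

/-- The Finsler regularity index
`C(Jf(x)) = sup_{R > 0} inf {C_Finsler(T) : T ∈ co Jf(B_X(x; R))}`. -/
def finslerRegularityIndex (NX : FinslerStructure E X) (NY : FinslerStructure F Y) (f : X → Y)
    (J : ∀ x : X, Set (TangentSpace 𝓘(ℝ, E) x →L[ℝ] TangentSpace 𝓘(ℝ, F) (f x)))
    (φ : OpenPartialHomeomorph X E) (ψ : OpenPartialHomeomorph Y F) (x : X) : ℝ≥0∞ :=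
  ⨆ (R : ℝ) (_ : 0 < R), ⨅ T ∈ convexHull ℝ (jacobianOnBall NX f J φ ψ x R),
    banachConstant NX NY x (f x) T

/-- The rate of surjection `cov f(x)`: the supremum of all `α > 0` for which there is a
neighbourhood `W` of `x` with `B_Y(f u; α r) ⊆ f(B_X(u; r))` whenever `u ∈ W`, `r > 0` and
`B_X(u; r) ⊆ W` (and `0` if there is no such `α`). -/
def rateOfSurjection (NX : FinslerStructure E X) (NY : FinslerStructure F Y) (f : X → Y) (x : X) :
    ℝ≥0∞ :=
  ⨆ (α : ℝ) (_ : 0 < α ∧ ∃ W ∈ 𝓝 x, ∀ u ∈ W, ∀ r : ℝ, 0 < r → NX.ball u r ⊆ W →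
    NY.ball (f u) (α * r) ⊆ f '' NX.ball u r), ENNReal.ofReal α

end Maps

end FinslerDefs

/-! Everything is read in the fixed charts, with the norms frozen: `p` is the Finsler norm at `x`
and `q` the one at `f x`. Take `α < β` below the index and let `g` be `f` in charts. If `g z ≠ y`,
smoothness of the norm gives a derivative `l` of `q` at `g z - y`, of dual norm one. Every `T` in
the pseudo-Jacobian at `z` has Banach constant above `β`, so no `l ∘ T` lies in the `β`-ball dual to
`p`. These functionals form a convex weak-star compact set, and separating it from that ball gives
one vector `v` with `l (T v) ≤ c < -β p v` for all `T`. The pseudo-Jacobian inequality then makes `q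
(g · - y)` decrease along `v` at rate at least `β` (`frequently_decrease_of_lt_banachConstant`), and
Ekeland's principle turns this into local surjectivity at rate `β`
(`exists_eq_of_frequently_decrease`).

Balls of `Y` are defined by lengths of paths, which may leave the chart, so local surjectivity is
propagated along a path. A second use of Ekeland's principle, on pairs (point, time) with `f` of the
point equal to `γ` at that time, yields a pair that cannot be continued; local surjectivity forces
its time to be `1` (`exists_eq_of_path`). Comparing frozen and moving norms costs a factor `1 + ε`
in `X` and another in `Y`, absorbed by the gap between `α` and `β`. -/

/-! ### Ekeland's variational principle. -/

section Ekeland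

/-- **Ekeland's variational principle** on a complete subset of a metric space, for a continuous
function and an auxiliary (possibly asymmetric) distance dominating the given one. -/
theorem exists_forall_add_le_imp_eq {Z : Type*} [MetricSpace Z] {S : Set Z} (hS : IsComplete S)
    {d : Z → Z → ℝ} {c : ℝ} (hc : 0 < c) (hcd : ∀ x y, c * dist x y ≤ d x y)
    (hself : ∀ x, d x x = 0) (htri : ∀ x y z, d x z ≤ d x y + d y z)
    (hd : ∀ x, Continuous (d x)) {h : Z → ℝ} (hh : ContinuousOn h S) {m : ℝ}
    (hm : ∀ z ∈ S, m ≤ h z) {z₀ : Z} (hz₀ : z₀ ∈ S) :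
    ∃ z ∈ S, h z + d z₀ z ≤ h z₀ ∧ ∀ w ∈ S, h w + d z w ≤ h z → w = z := by
  -- The successor of `z` at least halves the gap between `h z` and the infimum of `h` over the
  -- admissible set of `z`.
  have step : ∀ z : S, ∃ w : S, h w + d z w ≤ h z ∧
      ∀ v ∈ S, h v + d z v ≤ h z → h w ≤ (h z + h v) / 2 := by
    rintro ⟨z, hz⟩
    set T : Set Z := {w | w ∈ S ∧ h w + d z w ≤ h z} with hT
    have hzT : z ∈ T := ⟨hz, by simp [hself]⟩
    have hbdd : BddBelow (h '' T) := ⟨m, by rintro _ ⟨w, hw, rfl⟩; exact hm w hw.1⟩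
    rcases lt_or_ge (sInf (h '' T)) (h z) with hlt | hge
    · have : sInf (h '' T) < (h z + sInf (h '' T)) / 2 := by linarith
      obtain ⟨_, ⟨w, hw, rfl⟩, hwlt⟩ := exists_lt_of_csInf_lt ⟨_, mem_image_of_mem h hzT⟩ this
      refine ⟨⟨w, hw.1⟩, hw.2, fun v hv hv' => ?_⟩
      have := csInf_le hbdd (mem_image_of_mem h (show v ∈ T from ⟨hv, hv'⟩))
      dsimp only
      linarith
    · refine ⟨⟨z, hz⟩, hzT.2, fun v hv hv' => ?_⟩
      have := csInf_le hbdd (mem_image_of_mem h (show v ∈ T from ⟨hv, hv'⟩))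
      dsimp only
      linarith
  choose next hnext hmin using step
  let s : ℕ → S := fun n => next^[n] ⟨z₀, hz₀⟩
  have hs (n : ℕ) : s (n + 1) = next (s n) := Function.iterate_succ_apply' _ _ _
  have hle (n k : ℕ) : h (s (n + k)) + d (s n) (s (n + k)) ≤ h (s n) := by
    induction k with
    | zero => simp [hself]
    | succ k ih =>
      have h1 := hnext (s (n + k))
      rw [← hs] at h1
      have h2 := htri (s n) (s (n + k)) (s (n + k + 1))
      rw [← add_assoc]
      linarith
  have hd0 (x y : Z) : 0 ≤ d x y := (mul_nonneg hc.le dist_nonneg).trans (hcd x y)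
  have hanti : Antitone fun n => h (s n) := antitone_nat_of_succ_le fun n => by
    have := hle n 1
    linarith [hd0 (s n) (s (n + 1))]
  have hbdd : BddBelow (range fun n => h (s n)) :=
    ⟨m, by rintro _ ⟨n, rfl⟩; exact hm _ (s n).2⟩
  obtain ⟨l, hl⟩ : ∃ l, Tendsto (fun n => h (s n)) atTop (𝓝 l) :=
    ⟨_, tendsto_atTop_ciInf hanti hbdd⟩
  have hll (n : ℕ) : l ≤ h (s n) := hanti.le_of_tendsto hl n
  have hcau : CauchySeq fun n => (s n : Z) := by
    refine cauchySeq_of_le_tendsto_0' (fun n => c⁻¹ * (h (s n) - l)) (fun n k hnk => ?_) ?_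
    · obtain ⟨k, rfl⟩ := Nat.exists_eq_add_of_le hnk
      rw [← div_eq_inv_mul, le_div_iff₀ hc, mul_comm]
      linarith [hle n k, hcd (s n) (s (n + k)), hll (n + k)]
    · simpa using (hl.sub_const l).const_mul c⁻¹
  obtain ⟨z, hzS, hz⟩ := cauchySeq_tendsto_of_isComplete hS (fun n => (s n).2) hcau
  have hhz : h z = l := tendsto_nhds_unique
    ((hh z hzS).tendsto.comp (tendsto_nhdsWithin_iff.2 ⟨hz, .of_forall fun n => (s n).2⟩)) hl
  have hzn (n : ℕ) : h z + d (s n) z ≤ h (s n) := by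
    have : Tendsto (fun k => h (s (n + k)) + d (s n) (s (n + k))) atTop (𝓝 (l + d (s n) z)) := by
      simp_rw [add_comm n]
      exact ((tendsto_add_atTop_iff_nat n).2 hl).add
        (((hd _).tendsto z).comp ((tendsto_add_atTop_iff_nat n).2 hz))
    rw [hhz]
    exact le_of_tendsto' this (hle n)
  refine ⟨z, hzS, hzn 0, fun w hw hwz => ?_⟩
  -- Such a `w` is admissible at every stage `s n`, so the halving property applies to it and
  -- survives the limit. It gives `l ≤ h w`, which leaves no room for `d z w > 0`.
  have hwl : l ≤ (l + h w) / 2 := by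
    refine le_of_tendsto_of_tendsto' ((tendsto_add_atTop_iff_nat 1).2 hl)
      ((hl.add_const (h w)).div_const 2) fun n => ?_
    rw [hs]
    exact hmin _ w hw (by linarith [htri (s n) z w, hzn n])
  have := hcd z w
  have : dist z w ≤ 0 := by nlinarith [dist_nonneg (x := z) (y := w)]
  exact (dist_le_zero.1 this).symm

end Ekeland

/-! ### Seminorms, weak-star separation and local surjectivity. -/

section Seminorm

variable {E : Type*} [NormedAddCommGroup E] [NormedSpace ℝ E]
  {F : Type*} [NormedAddCommGroup F] [NormedSpace ℝ F]

theorem Seminorm.continuous_of_le_mul_norm {p : Seminorm ℝ E} {C : ℝ}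
    (hC : ∀ v, p v ≤ C * ‖v‖) : Continuous p := by
  have h0 : 0 ≤ |C| := abs_nonneg C
  refine (LipschitzWith.of_dist_le_mul (K := ⟨|C|, h0⟩) fun x y => ?_).continuous
  rw [Real.dist_eq, dist_eq_norm]
  exact (abs_sub_map_le_sub p x y).trans
    ((hC _).trans (mul_le_mul_of_nonneg_right (le_abs_self C) (norm_nonneg _)))

/-- By the triangle inequality, difference quotients of `q` along `v` never exceed `q v`. -/
theorem Seminorm.abs_fderiv_le {q : Seminorm ℝ F} {l : StrongDual ℝ F} {w : F}
    (h : HasFDerivAt q l w) (v : F) : |l v| ≤ q v := by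
  have h0 : HasDerivAt (fun t : ℝ => q (w + t • v)) (l v) 0 := by
    have := (h.hasLineDerivAt v)
    simpa [HasLineDerivAt] using this
  refine h0.le_of_lip' (apply_nonneg q v) (.of_forall fun t => ?_)
  have := abs_sub_map_le_sub q (w + t • v) (w + (0 : ℝ) • v)
  rw [Real.norm_eq_abs]
  refine this.trans_eq ?_
  simp [map_smul_eq_mul, mul_comm]

/-- By homogeneity `q` is affine along the ray through `w`. Together with `Seminorm.abs_fderiv_le`
this makes the derivative a norming functional. -/
theorem Seminorm.fderiv_apply_self {q : Seminorm ℝ F} {l : StrongDual ℝ F} {w : F}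
    (h : HasFDerivAt q l w) : l w = q w := by
  have h0 : HasDerivAt (fun t : ℝ => q (w + t • w)) (l w) 0 := by
    have := (h.hasLineDerivAt w)
    simpa [HasLineDerivAt] using this
  have h1 : HasDerivAt (fun t : ℝ => (1 + t) * q w) (q w) 0 := by
    simpa using ((hasDerivAt_id (0 : ℝ)).const_add 1).mul_const (q w)
  refine h0.unique (h1.congr_of_eventuallyEq ?_)
  filter_upwards [lt_mem_nhds (show (-1 : ℝ) < 0 by norm_num)] with t ht
  rw [show w + t • w = (1 + t) • w by rw [add_smul, one_smul], map_smul_eq_mul, Real.norm_eq_abs,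
    abs_of_nonneg (by linarith)]

/-- A continuous seminorm is attained by a continuous functional that it dominates. -/
theorem Seminorm.exists_strongDual_apply_eq_neg {p : Seminorm ℝ E} (hp : Continuous p) (w : E)
    {β : ℝ} (hβ : 0 ≤ β) : ∃ l : StrongDual ℝ E, (∀ v, |l v| ≤ β * p v) ∧ l w = -(β * p w) := by
  by_cases hw : w = 0
  · exact ⟨0, fun v => by simpa using mul_nonneg hβ (apply_nonneg p v), by simp [hw]⟩
  let f : E →ₗ.[ℝ] ℝ := LinearPMap.mkSpanSingleton (K := ℝ) w (-p w) hw
  have hf (t : ℝ) (ht : t • w ∈ f.domain) : f.toFun ⟨t • w, ht⟩ = t • (-p w) :=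
    LinearPMap.mkSpanSingleton'_apply _ _ _ _ _
  obtain ⟨g, hg, hle⟩ := Module.Dual.exists_continuous_extension_of_le_seminorm_real
    f.domain f.toFun hp (by
      rintro ⟨x, hx⟩
      obtain ⟨t, rfl⟩ := Submodule.mem_span_singleton.1 hx
      rw [hf, map_smul_eq_mul, smul_eq_mul, Real.norm_eq_abs]
      nlinarith [neg_le_abs t, apply_nonneg p w])
  have hgw : g w = -p w := by
    have hmem : (1 : ℝ) • w ∈ f.domain :=
      Submodule.smul_mem _ _ (Submodule.mem_span_singleton_self w)
    simpa only [one_smul] using (hg ⟨(1 : ℝ) • w, hmem⟩).trans (hf 1 hmem)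
  refine ⟨β • g, fun v => ?_, ?_⟩
  · rw [smul_apply, smul_eq_mul, abs_mul, abs_of_nonneg hβ]
    exact mul_le_mul_of_nonneg_left (hle v) hβ
  · rw [smul_apply, hgw, smul_eq_mul, mul_neg]

/-- Minimax: if a convex weak-star compact set of functionals does not meet the polar ball of
radius `β` for the seminorm `p`, this is detected by a single vector. -/
theorem exists_forall_apply_le_of_weakStar_compact {p : Seminorm ℝ E} (hp : Continuous p) {β : ℝ}
    (hβ : 0 ≤ β) {K : Set (StrongDual ℝ E)} (hK : Convex ℝ K)
    (hKc : IsCompact (StrongDual.toWeakDual '' K))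
    (hdisj : ∀ l ∈ K, ∃ v, β * p v < |l v|) :
    ∃ (v : E) (c : ℝ), c < -(β * p v) ∧ ∀ l ∈ K, l v ≤ c := by
  let D : Set (WeakDual ℝ E) := {l | ∀ v, |l v| ≤ β * p v}
  have hDclosed : IsClosed D := by
    simp only [D, ofPred_forall]
    exact isClosed_iInter fun v => isClosed_le (WeakDual.eval_continuous v).abs continuous_const
  have hDconv : Convex ℝ D := by
    intro l hl k hk a b ha hb hab v
    calc |a * l v + b * k v| ≤ a * |l v| + b * |k v| := by
          refine (abs_add_le _ _).trans ?_
          rw [abs_mul, abs_mul, abs_of_nonneg ha, abs_of_nonneg hb]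
      _ ≤ a * (β * p v) + b * (β * p v) := by gcongr; exacts [hl v, hk v]
      _ = β * p v := by rw [← add_mul, hab, one_mul]
  have hK' : Convex ℝ (StrongDual.toWeakDual '' K) :=
    hK.linear_image (StrongDual.toWeakDual (𝕜 := ℝ) (E := E)).toLinearMap
  have hd : Disjoint (StrongDual.toWeakDual '' K) D := by
    rw [Set.disjoint_left]
    rintro _ ⟨l, hl, rfl⟩ hD
    obtain ⟨v, hv⟩ := hdisj l hl
    exact absurd (hD v) (not_le.2 hv)
  have : LocallyConvexSpace ℝ (WeakDual ℝ E) :=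
    inferInstanceAs (LocallyConvexSpace ℝ (WeakBilin (topDualPairing ℝ E)))
  -- A weak-star continuous functional is evaluation at a vector `w`, and on the polar ball `D` this
  -- evaluation takes the value `-(β * p w)`. Hence `s < t < -(β * p w)`.
  obtain ⟨φ, s, t, h1, h2, h3⟩ := geometric_hahn_banach_compact_closed hK' hKc hDconv hDclosed hd
  obtain ⟨w, hw⟩ := LinearMap.dualEmbedding_surjective (topDualPairing ℝ E) φ
  have hφ (l : WeakDual ℝ E) : φ l = l w := by rw [← hw]; rfl
  obtain ⟨b, hb, hbw⟩ := Seminorm.exists_strongDual_apply_eq_neg hp w hβ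
  refine ⟨w, s, ?_, fun l hl => ?_⟩
  · have := h3 (StrongDual.toWeakDual b) hb
    rw [hφ] at this
    have e : StrongDual.toWeakDual b w = b w := rfl
    linarith
  · have := h1 _ (mem_image_of_mem _ hl)
    rw [hφ] at this
    exact this.le

/-- If every value `y ≠ g z` can be approached from `z` at rate at least `β`, then `g` is
surjective near `z₀` at rate `β`. -/
theorem exists_eq_of_frequently_decrease [CompleteSpace E] {p : Seminorm ℝ E} {q : Seminorm ℝ F}
    {c C : ℝ} (hc : 0 < c) (hpc : ∀ v, c * ‖v‖ ≤ p v) (hpC : ∀ v, p v ≤ C * ‖v‖)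
    (hq : Continuous q) {β δ : ℝ} (hβ : 0 < β)
    {g : E → F} {z₀ : E} (hg : ContinuousOn g {z | p (z - z₀) ≤ δ}) {y : F}
    (hdec : ∀ z, p (z - z₀) < δ → y ≠ g z →
      ∃ᶠ w in 𝓝[≠] z, q (g w - y) + β * p (w - z) ≤ q (g z - y))
    (hy : q (y - g z₀) < β * δ) : ∃ z, p (z - z₀) ≤ q (y - g z₀) / β ∧ g z = y := by
  have hp := Seminorm.continuous_of_le_mul_norm hpC
  have hq_le : 0 ≤ q (y - g z₀) := apply_nonneg _ _
  have hδ : 0 ≤ δ := by nlinarith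
  have hclosed : IsClosed {z | p (z - z₀) ≤ δ} :=
    isClosed_le (hp.comp (continuous_id.sub continuous_const)) continuous_const
  obtain ⟨z, hzS, hz, hmax⟩ := exists_forall_add_le_imp_eq hclosed.isComplete
    (d := fun x y => β * p (y - x)) (h := fun z => q (g z - y)) (mul_pos hβ hc)
    (fun x z => by
      rw [mul_assoc, dist_comm, dist_eq_norm]
      exact mul_le_mul_of_nonneg_left (hpc _) hβ.le)
    (fun x => by simp)
    (fun x z w => by
      rw [← mul_add]
      refine mul_le_mul_of_nonneg_left ?_ hβ.le
      rw [← sub_add_sub_cancel w z x, add_comm]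
      exact map_add_le_add p _ _)
    (fun x => continuous_const.mul (hp.comp (continuous_id.sub continuous_const)))
    (hq.comp_continuousOn (hg.sub continuousOn_const)) (m := 0)
    (fun z _ => apply_nonneg _ _) (z₀ := z₀) (by simpa using hδ)
  have hsymm : q (g z₀ - y) = q (y - g z₀) := map_sub_rev q _ _
  have hle : β * p (z - z₀) ≤ q (y - g z₀) := by
    linarith [apply_nonneg q (g z - y)]
  refine ⟨z, by rwa [le_div_iff₀ hβ, mul_comm], ?_⟩
  by_contra hne
  -- The strict bound on `q (y - g z₀)` keeps the Ekeland point off the boundary, so that nearby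
  -- decreasing points are still competitors.
  have hlt : p (z - z₀) < δ := by
    by_contra! hge
    nlinarith
  have hnhds : ∀ᶠ w in 𝓝[≠] z, p (w - z₀) < δ :=
    nhdsWithin_le_nhds ((hp.comp (continuous_id.sub continuous_const)).continuousAt.eventually_lt_const hlt)
  obtain ⟨w, hw, hwδ, hwz⟩ :=
    ((hdec z hlt (Ne.symm hne)).and_eventually (hnhds.and self_mem_nhdsWithin)).exists
  exact hwz (hmax w hwδ.le hw)

end Seminorm

/-! ### Directional bounds: chain rule and descent directions. -/

section DirectionalBound

open Asymptotics

variable {E : Type*} [NormedAddCommGroup E] [NormedSpace ℝ E]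
  {F : Type*} [NormedAddCommGroup F] [NormedSpace ℝ F]
  {G : Type*} [NormedAddCommGroup G] [NormedSpace ℝ G]
  {H : Type*} [NormedAddCommGroup H] [NormedSpace ℝ H]

/-- The upper right Dini derivatives at `z` of all scalarizations of `g` are bounded by the
support function of the set of operators `A`, in terms of real numbers. -/
def HasDirectionalBound (g : E → F) (A : Set (E →L[ℝ] F)) (z : E) : Prop :=
  ∀ (y' : StrongDual ℝ F) (v : E) (c : ℝ), (∀ T ∈ A, y' (T v) ≤ c) → ∀ ε > 0,
    ∀ᶠ t in 𝓝[>] (0 : ℝ), y' (g (z + t • v) - g z) ≤ (c + ε) * t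

theorem IsPseudoJacobianAt.hasDirectionalBound {g : E → F} {A : Set (E →L[ℝ] F)} {z : E}
    (h : IsPseudoJacobianAt g A z) : HasDirectionalBound g A z := by
  intro y' v c hc ε hε
  have h1 : upperDini (fun z => y' (g z)) z v < ((c + ε : ℝ) : EReal) := by
    refine (h.2 y' v).trans_lt (lt_of_le_of_lt (iSup₂_le fun T hT => ?_)
      (EReal.coe_lt_coe_iff.2 (lt_add_of_pos_right c hε)))
    exact EReal.coe_le_coe_iff.2 (hc T hT)
  filter_upwards [eventually_lt_of_limsup_lt h1, self_mem_nhdsWithin] with t ht ht0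
  have := (EReal.coe_lt_coe_iff.1 ht).le
  rwa [div_le_iff₀ ht0, ← map_sub] at this

theorem HasDirectionalBound.congr {g g₁ : E → F} {A : Set (E →L[ℝ] F)} {z : E}
    (h : HasDirectionalBound g A z) (hg : g₁ =ᶠ[𝓝 z] g) : HasDirectionalBound g₁ A z := by
  intro y' v c hc ε hε
  have hlim : Tendsto (fun t : ℝ => z + t • v) (𝓝[>] 0) (𝓝 z) := by
    have : Tendsto (fun t : ℝ => z + t • v) (𝓝 0) (𝓝 (z + (0 : ℝ) • v)) :=
      Continuous.tendsto (by fun_prop) 0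
    simpa using this.mono_left nhdsWithin_le_nhds
  filter_upwards [h y' v c hc ε hε, hlim.eventually hg] with t ht ht'
  rwa [ht', hg.eq_of_nhds]

/-- The chain rule for directional bounds. -/
theorem HasDirectionalBound.comp {g : E → F} {A : Set (E →L[ℝ] F)} {k : G → E} {h : F → H} {z : G}
    (hA : HasDirectionalBound g A (k z)) {Q : G →L[ℝ] E} (hk : HasFDerivAt k Q z)
    {P : F →L[ℝ] H} (hh : HasFDerivAt h P (g (k z))) {K : ℝ≥0} {s : Set E}
    (hg : LipschitzOnWith K g s) (hs : s ∈ 𝓝 (k z)) :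
    HasDirectionalBound (fun u => h (g (k u))) ((fun T => P.comp (T.comp Q)) '' A) z := by
  intro y' v c hc ε hε
  -- One half of `ε` goes to the bound for `g` along a straight line, the other to the linearization
  -- errors of `h` and `k`.
  have hbound := hA (y'.comp P) (Q v) c (fun T hT => hc _ (mem_image_of_mem _ hT)) (ε / 2)
    (half_pos hε)
  have hline : Tendsto (fun t : ℝ => z + t • v) (𝓝[>] 0) (𝓝 z) := by
    have : Tendsto (fun t : ℝ => z + t • v) (𝓝 0) (𝓝 (z + (0 : ℝ) • v)) :=
      Continuous.tendsto (by fun_prop) 0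
    simpa using this.mono_left nhdsWithin_le_nhds
  have hline' : Tendsto (fun t : ℝ => k z + t • Q v) (𝓝[>] 0) (𝓝 (k z)) := by
    have : Tendsto (fun t : ℝ => k z + t • Q v) (𝓝 0) (𝓝 (k z + (0 : ℝ) • Q v)) :=
      Continuous.tendsto (by fun_prop) 0
    simpa using this.mono_left nhdsWithin_le_nhds
  have hkline := hk.continuousAt.tendsto.comp hline
  have hOv : (fun t : ℝ => t • v) =O[𝓝[>] 0] (fun t : ℝ => t) :=
    IsBigO.of_bound ‖v‖ (.of_forall fun t => by rw [norm_smul, mul_comm])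
  have hko : (fun t : ℝ => k (z + t • v) - k z - t • Q v) =o[𝓝[>] 0] (fun t : ℝ => t) := by
    have := (hk.isLittleO.comp_tendsto hline)
    simp only [Function.comp_def, add_sub_cancel_left, map_smul] at this
    exact this.trans_isBigO hOv
  have hkO : (fun t : ℝ => k (z + t • v) - k z) =O[𝓝[>] 0] (fun t : ℝ => t) := by
    have h2 : (fun t : ℝ => t • Q v) =O[𝓝[>] 0] (fun t : ℝ => t) :=
      IsBigO.of_bound ‖Q v‖ (.of_forall fun t => by rw [norm_smul, mul_comm])
    simpa using hko.isBigO.add h2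
  have hgO : (fun t : ℝ => g (k (z + t • v)) - g (k z)) =O[𝓝[>] 0] (fun t : ℝ => t) := by
    refine (IsBigO.of_bound K ?_).trans hkO
    filter_upwards [hkline hs] with t ht
    exact hg.norm_sub_le ht (mem_of_mem_nhds hs)
  -- The bound on `g` concerns straight lines only; the Lipschitz condition allows the curve `k (z +
  -- t • v)` to be replaced by its tangent line at cost `o(t)`.
  have hgo : (fun t : ℝ => g (k (z + t • v)) - g (k z + t • Q v)) =o[𝓝[>] 0]
      (fun t : ℝ => t) := by
    refine (IsBigO.of_bound K ?_).trans_isLittleO hko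
    filter_upwards [hkline hs, hline' hs] with t ht ht'
    refine (hg.norm_sub_le ht ht').trans_eq ?_
    simp [sub_sub]
  have hglim : Tendsto (fun t : ℝ => g (k (z + t • v))) (𝓝[>] 0) (𝓝 (g (k z))) :=
    (hg.continuousOn.continuousAt hs).tendsto.comp hkline
  have hho : (fun t : ℝ => h (g (k (z + t • v))) - h (g (k z)) - P (g (k (z + t • v)) - g (k z)))
      =o[𝓝[>] 0] (fun t : ℝ => t) :=
    (hh.isLittleO.comp_tendsto hglim).trans_isBigO hgO
  have htot := ((y'.isBigO_comp _ _).trans_isLittleO hho).add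
    (((y'.comp P).isBigO_comp _ _).trans_isLittleO hgo)
  filter_upwards [hbound, htot.def (half_pos hε), self_mem_nhdsWithin] with t h1 h2 h3
  rw [mem_Ioi] at h3
  simp only [Real.norm_eq_abs, abs_of_pos h3, ContinuousLinearMap.comp_apply, map_sub] at h1 h2 ⊢
  have := le_of_abs_le h2
  linarith

/-- A directional bound yields points at which the distance to `y` decreases at rate `β`. -/
theorem HasDirectionalBound.frequently_decrease {p : Seminorm ℝ E} {q : Seminorm ℝ F} {β : ℝ}
    {g : E → F} {A : Set (E →L[ℝ] F)} {z : E} (hA : HasDirectionalBound g A z) (hne : A.Nonempty)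
    {K : ℝ≥0} {s : Set E} (hg : LipschitzOnWith K g s) (hs : s ∈ 𝓝 z) {y : F}
    {l : StrongDual ℝ F} (hl : HasFDerivAt q l (g z - y)) {v : E} {c : ℝ}
    (hcv : c < -(β * p v)) (hc : ∀ T ∈ A, l (T v) ≤ c) :
    ∃ᶠ w in 𝓝[≠] z, q (g w - y) + β * p (w - z) ≤ q (g z - y) := by
  -- If `v = 0`, any `T ∈ A` gives `0 ≤ c < 0`. A nonzero `v` is needed for the points `z + t • v`
  -- to differ from `z`.
  have hv : v ≠ 0 := by
    rintro rfl
    obtain ⟨T, hT⟩ := hne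
    have := hc T hT
    simp only [map_zero, mul_zero, neg_zero] at this hcv
    linarith
  have hq : HasFDerivAt (fun w => q (w - y)) l (g (id z)) := by
    have h1 : HasFDerivAt (fun w : F => w - y) (ContinuousLinearMap.id ℝ F) (g z) :=
      (hasFDerivAt_id _).sub_const y
    have h2 := HasFDerivAt.comp (g z) hl h1
    rwa [ContinuousLinearMap.comp_id] at h2
  -- The slack is chosen to be exactly `-(β * p v) - c`, so that the resulting slope is `-(β * p
  -- v)`.
  have key := HasDirectionalBound.comp (k := id) hA (hasFDerivAt_id z) hq hg hs
    (ContinuousLinearMap.id ℝ ℝ) v c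
    (by rintro _ ⟨T, hT, rfl⟩; exact hc T hT) (-(β * p v) - c) (by linarith)
  have hlim : Tendsto (fun t : ℝ => z + t • v) (𝓝[>] 0) (𝓝[≠] z) := by
    refine tendsto_nhdsWithin_iff.2 ⟨?_, ?_⟩
    · have : Tendsto (fun t : ℝ => z + t • v) (𝓝 0) (𝓝 (z + (0 : ℝ) • v)) :=
        Continuous.tendsto (by fun_prop) 0
      simpa using this.mono_left nhdsWithin_le_nhds
    · filter_upwards [self_mem_nhdsWithin] with t ht
      have : t ≠ 0 := ne_of_gt ht
      simp [this, hv]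
  refine hlim.frequently (Eventually.frequently ?_)
  filter_upwards [key, self_mem_nhdsWithin] with t ht ht0
  rw [mem_Ioi] at ht0
  simp only [id, ContinuousLinearMap.id_apply] at ht
  rw [add_sub_cancel_left, map_smul_eq_mul, Real.norm_eq_abs, abs_of_pos ht0]
  linarith

/-- The image of a WOT compact set of operators under composition with a functional is weak-star
compact. -/
theorem IsWOTCompact.isCompact_image_comp {A : Set (E →L[ℝ] F)} (hA : IsWOTCompact A)
    (l : StrongDual ℝ F) (Q : G →L[ℝ] E) :
    IsCompact (StrongDual.toWeakDual '' ((fun T : E →L[ℝ] F => l.comp (T.comp Q)) '' A)) := by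
  have hcont : Continuous fun T : E →WOT[ℝ] F =>
      StrongDual.toWeakDual (l.comp (T.toCLM.comp Q)) :=
    WeakDual.continuous_of_continuous_eval fun v =>
      ContinuousLinearMapWOT.continuous_dual_apply (Q v) l
  have := hA.image hcont
  rw [image_image] at this
  rwa [image_image]

/-- If a directional bound is given by a convex WOT compact set of operators (up to a linear change
of variables), it suffices to bound from below the adjoint of each single operator. -/
theorem HasDirectionalBound.frequently_decrease_of_isWOTCompact {p : Seminorm ℝ E}
    (hp : Continuous p) {q : Seminorm ℝ F} {β : ℝ} (hβ : 0 ≤ β) {g : E → F}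
    {B : Set (G →L[ℝ] H)} (hB : B.Nonempty) (hBconv : Convex ℝ B) (hBcomp : IsWOTCompact B)
    {P : H →L[ℝ] F} {Q : E →L[ℝ] G} {z : E}
    (hA : HasDirectionalBound g ((fun T => P.comp (T.comp Q)) '' B) z)
    {K : ℝ≥0} {s : Set E} (hg : LipschitzOnWith K g s) (hs : s ∈ 𝓝 z) {y : F}
    {l : StrongDual ℝ F} (hl : HasFDerivAt q l (g z - y))
    (hlB : ∀ T ∈ B, ¬ ∀ v, |l (P (T (Q v)))| ≤ β * p v) :
    ∃ᶠ w in 𝓝[≠] z, q (g w - y) + β * p (w - z) ≤ q (g z - y) := by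
  have hconv : Convex ℝ ((fun T : G →L[ℝ] H => (l.comp P).comp (T.comp Q)) '' B) := by
    refine hBconv.is_linear_image ⟨fun S T => ?_, fun c T => ?_⟩ <;> ext v <;> simp
  obtain ⟨v, c, hcv, hv⟩ := exists_forall_apply_le_of_weakStar_compact hp hβ hconv
    (hBcomp.isCompact_image_comp (l.comp P) Q) (by
      rintro _ ⟨T, hT, rfl⟩
      simpa using hlB T hT)
  refine hA.frequently_decrease (hB.image _) hg hs hl hcv ?_
  rintro _ ⟨T, hT, rfl⟩
  exact hv _ (mem_image_of_mem _ hT)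

end DirectionalBound

/-! ### Change of charts. -/

section ChartCalculus

variable {E : Type*} [NormedAddCommGroup E] [NormedSpace ℝ E]
  {F : Type*} [NormedAddCommGroup F] [NormedSpace ℝ F]
  {X : Type*} [TopologicalSpace X] [ChartedSpace E X]
  {Y : Type*} [TopologicalSpace Y] [ChartedSpace F Y]

theorem IsChartAt.of_mem {φ : OpenPartialHomeomorph X E} {x u : X} (h : IsChartAt φ x)
    (hu : u ∈ φ.source) : IsChartAt φ u := ⟨h.1, hu⟩

theorem IsChartPair.of_mem {f : X → Y} {φ : OpenPartialHomeomorph X E}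
    {ψ : OpenPartialHomeomorph Y F} {x u : X} (h : IsChartPair f x φ ψ) (hu : u ∈ φ.source) :
    IsChartPair f u φ ψ :=
  ⟨h.source.of_mem hu, h.target.of_mem (h.mapsTo hu), h.mapsTo⟩

theorem IsChartAt.mdifferentiable {φ : OpenPartialHomeomorph X E} {x : X} (h : IsChartAt φ x) :
    φ.MDifferentiable 𝓘(ℝ, E) 𝓘(ℝ, E) :=
  ⟨(contMDiffOn_of_mem_maximalAtlas h.1).mdifferentiableOn one_ne_zero,
    (contMDiffOn_symm_of_mem_maximalAtlas h.1).mdifferentiableOn one_ne_zero⟩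

theorem IsChartAt.chartDerivSymm_chartDeriv {φ : OpenPartialHomeomorph X E} {x : X}
    (h : IsChartAt φ x) (w : TangentSpace 𝓘(ℝ, E) x) :
    chartDerivSymm φ x (chartDeriv φ x w) = w :=
  DFunLike.congr_fun (h.mdifferentiable.symm_comp_deriv h.2) w

theorem IsChartAt.chartDeriv_chartDerivSymm {φ : OpenPartialHomeomorph X E} {x : X}
    (h : IsChartAt φ x) (v : E) : chartDeriv φ x (chartDerivSymm φ x v) = v := by
  have := h.mdifferentiable.comp_symm_deriv (φ.map_source h.2)
  rw [φ.left_inv h.2] at this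
  exact DFunLike.congr_fun this v

theorem IsChartAt.contDiffAt_transition {φ φ' : OpenPartialHomeomorph X E} {x : X}
    (h : IsChartAt φ x) (h' : IsChartAt φ' x) :
    ContDiffAt ℝ 1 (fun z => φ' (φ.symm z)) (φ x) := by
  rw [← contMDiffAt_iff_contDiffAt]
  have h1 : ContMDiffAt 𝓘(ℝ, E) 𝓘(ℝ, E) 1 φ.symm (φ x) :=
    contMDiffAt_symm_of_mem_maximalAtlas h.1 (φ.map_source h.2)
  have h2 : ContMDiffAt 𝓘(ℝ, E) 𝓘(ℝ, E) 1 φ' (φ.symm (φ x)) :=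
    contMDiffAt_of_mem_maximalAtlas h'.1 (by rw [φ.left_inv h.2]; exact h'.2)
  exact h2.comp _ h1

theorem IsChartAt.hasFDerivAt_transition {φ φ' : OpenPartialHomeomorph X E} {x : X}
    (h : IsChartAt φ x) (h' : IsChartAt φ' x) :
    HasFDerivAt (fun z => φ' (φ.symm z)) ((chartDeriv φ' x).comp (chartDerivSymm φ x)) (φ x) := by
  have h1 : HasMFDerivAt 𝓘(ℝ, E) 𝓘(ℝ, E) φ.symm (φ x) (chartDerivSymm φ x) :=
    (h.mdifferentiable.mdifferentiableAt_symm (φ.map_source h.2)).hasMFDerivAt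
  have h2 : HasMFDerivAt 𝓘(ℝ, E) 𝓘(ℝ, E) φ' (φ.symm (φ x)) (chartDeriv φ' (φ.symm (φ x))) :=
    (h'.mdifferentiable.mdifferentiableAt (by rw [φ.left_inv h.2]; exact h'.2)).hasMFDerivAt
  have h3 := (h2.comp _ h1).hasFDerivAt
  rw [φ.left_inv h.2] at h3
  exact h3

theorem IsLocallyLipschitz.continuous {f : X → Y} (hf : IsLocallyLipschitz E F f) :
    Continuous f := by
  rw [continuous_iff_continuousAt]
  intro x
  obtain ⟨φ, ψ, h, K, hK⟩ := hf x
  have h1 : ContinuousAt (inCharts f φ ψ) (φ x) :=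
    hK.continuousOn.continuousAt (φ.open_target.mem_nhds (φ.map_source h.source.2))
  have h2 : ContinuousAt (fun u => ψ.symm (inCharts f φ ψ (φ u))) x := by
    refine ContinuousAt.comp (g := ψ.symm) ?_ (h1.comp (φ.continuousAt h.source.2))
    refine ψ.continuousAt_symm ?_
    simp only [inCharts, φ.left_inv h.source.2]
    exact ψ.map_source h.target.2
  refine h2.congr ?_
  filter_upwards [φ.open_source.mem_nhds h.source.2] with u hu
  simp only [inCharts, φ.left_inv hu]
  exact ψ.left_inv (h.mapsTo hu)

theorem IsChartPair.inCharts_eventuallyEq {f : X → Y} {x : X} {φ φ' : OpenPartialHomeomorph X E}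
    {ψ ψ' : OpenPartialHomeomorph Y F} (h : IsChartPair f x φ ψ) (h' : IsChartPair f x φ' ψ') :
    inCharts f φ ψ =ᶠ[𝓝 (φ x)]
      fun z => ψ (ψ'.symm (inCharts f φ' ψ' (φ' (φ.symm z)))) := by
  have hφ := φ.continuousAt_symm (φ.map_source h.source.2)
  have : φ'.source ∈ 𝓝 (φ.symm (φ x)) := by
    rw [φ.left_inv h.source.2]
    exact φ'.open_source.mem_nhds h'.source.2
  filter_upwards [hφ this] with z hz
  simp only [inCharts]
  rw [φ'.left_inv hz, ψ'.left_inv (h'.mapsTo hz)]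

/-- Local Lipschitz continuity holds in every pair of charts. -/
theorem IsLocallyLipschitz.exists_lipschitzOnWith {f : X → Y} (hf : IsLocallyLipschitz E F f)
    {x : X} {φ : OpenPartialHomeomorph X E} {ψ : OpenPartialHomeomorph Y F}
    (h : IsChartPair f x φ ψ) :
    ∃ K : ℝ≥0, ∃ s ∈ 𝓝 (φ x), LipschitzOnWith K (inCharts f φ ψ) s := by
  obtain ⟨φ', ψ', h', K, hK⟩ := hf x
  obtain ⟨K₁, s₁, hs₁, hK₁⟩ := (h.source.contDiffAt_transition h'.source).exists_lipschitzOnWith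
  obtain ⟨K₂, s₂, hs₂, hK₂⟩ := (h'.target.contDiffAt_transition h.target).exists_lipschitzOnWith
  have heq := h.inCharts_eventuallyEq h'
  set k : E → E := fun z => φ' (φ.symm z)
  set g : E → F := inCharts f φ' ψ'
  have hkx : k (φ x) = φ' x := by simp only [k, φ.left_inv h.source.2]
  have hgx : g (φ' x) = ψ' (f x) := by simp only [g, inCharts, φ'.left_inv h'.source.2]
  have hk : ContinuousAt k (φ x) := hK₁.continuousOn.continuousAt hs₁
  have hg : ContinuousAt g (φ' x) :=
    hK.continuousOn.continuousAt (φ'.open_target.mem_nhds (φ'.map_source h'.source.2))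
  have ht : k ⁻¹' φ'.target ∈ 𝓝 (φ x) := hk (by
    rw [hkx]; exact φ'.open_target.mem_nhds (φ'.map_source h'.source.2))
  have ht₂ : k ⁻¹' (g ⁻¹' s₂) ∈ 𝓝 (φ x) := hk (by
    rw [hkx]; exact hg (by rwa [hgx]))
  refine ⟨K₂ * (K * K₁), _, inter_mem (inter_mem (inter_mem hs₁ ht) ht₂) heq, ?_⟩
  have hcomp := hK₂.comp (hK.comp (hK₁.mono (inter_subset_left.trans inter_subset_left))
    (fun z hz => hz.1.2)) (fun z hz => hz.2) (s := (s₁ ∩ k ⁻¹' φ'.target) ∩ k ⁻¹' (g ⁻¹' s₂))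
  intro z hz w hw
  have hz2 := hz.2
  have hw2 := hw.2
  simp only [mem_ofPred_eq] at hz2 hw2
  rw [hz2, hw2]
  exact hcomp hz.1 hw.1

/-- The representation of a set of operators from `T_x X` to `T_{f x} Y` in a pair of charts. -/
def chartOperators (f : X → Y) (x : X) (φ : OpenPartialHomeomorph X E)
    (ψ : OpenPartialHomeomorph Y F)
    (A : Set (TangentSpace 𝓘(ℝ, E) x →L[ℝ] TangentSpace 𝓘(ℝ, F) (f x))) : Set (E →L[ℝ] F) :=
  (fun T => (chartDeriv ψ (f x)).comp (T.comp (chartDerivSymm φ x))) '' A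

/-- Convexity and compactness are available for `JJ`, in charts that vary with the point. This
transfers them to the fixed charts through the derivatives of the transition maps. -/
theorem IsChartPseudoJacobian.chartOperators_eq {f : X → Y} {x : X}
    {A : Set (TangentSpace 𝓘(ℝ, E) x →L[ℝ] TangentSpace 𝓘(ℝ, F) (f x))}
    {φ φ' : OpenPartialHomeomorph X E} {ψ ψ' : OpenPartialHomeomorph Y F}
    {JJ : E → Set (E →L[ℝ] F)} (hJ : IsChartPseudoJacobian f x A φ' ψ' JJ) :
    chartOperators f x φ ψ A = (fun T : E →L[ℝ] F =>
      ((chartDeriv ψ (f x)).comp (chartDerivSymm ψ' (f x))).comp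
        (T.comp ((chartDeriv φ' x).comp (chartDerivSymm φ x)))) '' JJ (φ' x) := by
  rw [chartOperators, hJ.represents, image_image]
  rfl

/-- A pseudo-Jacobian in one pair of charts provides a directional bound in every other. -/
theorem IsChartPseudoJacobian.hasDirectionalBound {f : X → Y} (hf : IsLocallyLipschitz E F f)
    {x : X} {A : Set (TangentSpace 𝓘(ℝ, E) x →L[ℝ] TangentSpace 𝓘(ℝ, F) (f x))}
    {φ φ' : OpenPartialHomeomorph X E} {ψ ψ' : OpenPartialHomeomorph Y F}
    {JJ : E → Set (E →L[ℝ] F)} (hJ : IsChartPseudoJacobian f x A φ' ψ' JJ)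
    (h : IsChartPair f x φ ψ) :
    HasDirectionalBound (inCharts f φ ψ) (chartOperators f x φ ψ A) (φ x) := by
  have h' := hJ.chartPair
  obtain ⟨K, s, hs, hK⟩ := hf.exists_lipschitzOnWith h'
  have hx : φ' (φ.symm (φ x)) = φ' x := by rw [φ.left_inv h.source.2]
  have hy : inCharts f φ' ψ' (φ' x) = ψ' (f x) := by
    simp only [inCharts, φ'.left_inv h'.source.2]
  have hb := (hJ.pseudoJacobian _ (φ'.map_source h'.source.2)).hasDirectionalBound
  rw [hJ.chartOperators_eq]
  refine (HasDirectionalBound.comp (k := fun z => φ' (φ.symm z)) (h := fun w => ψ (ψ'.symm w))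
    (by rwa [hx]) (h.source.hasFDerivAt_transition h'.source) ?_ hK (by rwa [hx])).congr
    (h.inCharts_eventuallyEq h')
  rw [hx, hy]
  exact h'.target.hasFDerivAt_transition h.target

end ChartCalculus

/-! ### Finsler norms in a chart and their derivatives. -/

section FinslerNorm

variable {E : Type*} [NormedAddCommGroup E] [NormedSpace ℝ E]
  {X : Type*} [TopologicalSpace X] [ChartedSpace E X] [IsManifold 𝓘(ℝ, E) 1 X]

/-- The Finsler norm at `x`, read in a chart. -/
noncomputable def FinslerStructure.chartSeminorm (N : FinslerStructure E X) (φ : OpenPartialHomeomorph X E)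
    (x : X) : Seminorm ℝ E :=
  (N.toSeminorm x).comp (chartDerivSymm φ x).toLinearMap

theorem FinslerStructure.chartSeminorm_apply (N : FinslerStructure E X)
    (φ : OpenPartialHomeomorph X E) (x : X) (v : E) :
    N.chartSeminorm φ x v = N.toSeminorm x (chartDerivSymm φ x v) := rfl

theorem FinslerStructure.chartSeminorm_chartDeriv (N : FinslerStructure E X)
    {φ : OpenPartialHomeomorph X E} {x : X} (h : IsChartAt φ x) (w : TangentSpace 𝓘(ℝ, E) x) :
    N.chartSeminorm φ x (chartDeriv φ x w) = N.toSeminorm x w := by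
  rw [chartSeminorm_apply, h.chartDerivSymm_chartDeriv]

theorem FinslerStructure.dualNorm_le (N : FinslerStructure E X) {x : X}
    {l : TangentSpace 𝓘(ℝ, E) x →L[ℝ] ℝ} {β : ℝ} (hβ : 0 ≤ β)
    (hl : ∀ v, |l v| ≤ β * N.toSeminorm x v) : N.dualNorm x l ≤ ENNReal.ofReal β :=
  iSup_le fun ⟨v, hv⟩ => ENNReal.ofReal_le_ofReal ((hl v).trans (mul_le_of_le_one_right hβ hv))

theorem FinslerStructure.toSeminorm_pos (N : FinslerStructure E X) {x : X}
    {φ : OpenPartialHomeomorph X E} (h : IsChartAt φ x)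
    {w : TangentSpace 𝓘(ℝ, E) x} (hw : w ≠ 0) : 0 < N.toSeminorm x w := by
  obtain ⟨c, hc, C, -, hcC⟩ := N.equivalent x φ h
  have h1 := (hcC (chartDeriv φ x w)).1
  rw [h.chartDerivSymm_chartDeriv] at h1
  refine lt_of_lt_of_le (mul_pos hc (norm_pos_iff.2 fun h0 => hw ?_)) h1
  rw [← h.chartDerivSymm_chartDeriv w, h0, map_zero]

/-- The derivative of a smooth Finsler norm has dual norm one. -/
theorem FinslerStructure.HasSmoothNorm.exists_hasFDerivAt {N : FinslerStructure E X}
    (hN : N.HasSmoothNorm) {φ : OpenPartialHomeomorph X E} {x : X} (h : IsChartAt φ x) {w : E}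
    (hw : w ≠ 0) : ∃ l : TangentSpace 𝓘(ℝ, E) x →L[ℝ] ℝ, N.dualNorm x l = 1 ∧
      HasFDerivAt (N.chartSeminorm φ x) (l.comp (chartDerivSymm φ x)) w := by
  let u := chartDerivSymm φ x w
  have hu : u ≠ 0 := fun h0 => hw (by
    rw [← h.chartDeriv_chartDerivSymm w]; exact (congrArg _ h0).trans (map_zero _))
  obtain ⟨l, hl⟩ := hN x u hu
  have habs : ∀ v, |l v| ≤ N.toSeminorm x v := Seminorm.abs_fderiv_le (F := E) hl
  have hself : l u = N.toSeminorm x u := Seminorm.fderiv_apply_self (F := E) hl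
  have hpos := N.toSeminorm_pos h hu
  refine ⟨l, le_antisymm (iSup_le fun ⟨v, hv⟩ => ?_) ?_, ?_⟩
  · rw [ENNReal.ofReal_le_one]
    exact (habs v).trans hv
  · refine le_iSup_of_le ⟨(N.toSeminorm x u)⁻¹ • u, ?_⟩ ?_
    · rw [map_smul_eq_mul, norm_inv, Real.norm_of_nonneg hpos.le, inv_mul_cancel₀ hpos.ne']
    · rw [map_smul, hself, smul_eq_mul, inv_mul_cancel₀ hpos.ne']
      simp
  · have hd : HasFDerivAt (chartDerivSymm φ x : E → E) (chartDerivSymm φ x : E →L[ℝ] E) w :=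
      ContinuousLinearMap.hasFDerivAt (chartDerivSymm φ x : E →L[ℝ] E)
    exact HasFDerivAt.comp (F := E) (g := fun v : E => N.toSeminorm x v) w hl hd

end FinslerNorm

/-! ### Finsler distance, lengths of paths and chart norms. -/

section Length

open MeasureTheory

variable {E : Type*} [NormedAddCommGroup E] [NormedSpace ℝ E]
  {X : Type*} [TopologicalSpace X] [ChartedSpace E X] [IsManifold 𝓘(ℝ, E) 1 X]

namespace FinslerStructure

/-- The extended norms on the tangent spaces which define the Finsler distance. -/
@[reducible] noncomputable def tangentENorm (N : FinslerStructure E X) (z : X) :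
    ENorm (TangentSpace 𝓘(ℝ, E) z) :=
  ⟨fun v => ENNReal.ofReal (N.toSeminorm z v)⟩

theorem tangentENormSMulClass (N : FinslerStructure E X) (z : X) :
    letI := N.tangentENorm z
    ENormSMulClass ℝ (TangentSpace 𝓘(ℝ, E) z) := by
  let := N.tangentENorm z
  refine ⟨fun c v => ?_⟩
  change ENNReal.ofReal (N.toSeminorm z (c • v)) = ‖c‖ₑ * ENNReal.ofReal (N.toSeminorm z v)
  rw [map_smul_eq_mul, ENNReal.ofReal_mul (norm_nonneg c), ofReal_norm]

omit [IsManifold 𝓘(ℝ, E) 1 X] in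
-- The left side is a derivative at `φ (φ.symm z)`, equal to `z` only propositionally; both sides
-- are viewed as maps `E →L[ℝ] E` so that the equation typechecks.
theorem chartDerivSymm_symm {φ : OpenPartialHomeomorph X E} {z : E} (hz : z ∈ φ.target) :
    (chartDerivSymm φ (φ.symm z) : E →L[ℝ] E) = mfderiv 𝓘(ℝ, E) 𝓘(ℝ, E) φ.symm z := by
  have : ∀ w, w = z → (mfderiv 𝓘(ℝ, E) 𝓘(ℝ, E) φ.symm w : E →L[ℝ] E) =
      mfderiv 𝓘(ℝ, E) 𝓘(ℝ, E) φ.symm z := by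
    rintro w rfl
    rfl
  exact this _ (φ.right_inv hz)

theorem edist_comm (N : FinslerStructure E X) (x y : X) : N.edist x y = N.edist y x := by
  let := N.tangentENorm
  have := N.tangentENormSMulClass
  exact riemannianEDist_comm

theorem mem_ball' (N : FinslerStructure E X) {x z : X} {r : ℝ} :
    z ∈ N.ball x r ↔ N.edist x z < ENNReal.ofReal r := by
  rw [N.edist_comm]
  rfl

/-- The Finsler distance is bounded by the length of a segment in a chart. -/
theorem edist_symm_le (N : FinslerStructure E X) {φ : OpenPartialHomeomorph X E}
    (hφ : φ ∈ IsManifold.maximalAtlas 𝓘(ℝ, E) 1 X) {z z' : E} {M : ℝ}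
    (hseg : ∀ w ∈ segment ℝ z z', w ∈ φ.target ∧ N.chartSeminorm φ (φ.symm w) (z' - z) ≤ M) :
    N.edist (φ.symm z) (φ.symm z') ≤ ENNReal.ofReal M := by
  let := N.tangentENorm
  have := N.tangentENormSMulClass
  have hmem : ∀ t ∈ Icc (0 : ℝ) 1, z + t • (z' - z) ∈ segment ℝ z z' := fun t ht => by
    rw [segment_eq_image']
    exact mem_image_of_mem _ ht
  let γ : ℝ → X := fun t => φ.symm (z + t • (z' - z))
  have hγ : ContMDiffOn 𝓘(ℝ, ℝ) 𝓘(ℝ, E) 1 γ (Icc 0 1) := by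
    refine (contMDiffOn_symm_of_mem_maximalAtlas hφ).comp (t := φ.target)
      (f := fun t : ℝ => z + t • (z' - z)) ?_ (fun t ht => (hseg _ (hmem t ht)).1)
    rw [contMDiffOn_iff_contDiffOn]
    exact ContDiff.contDiffOn (by fun_prop)
  have hle : riemannianEDist 𝓘(ℝ, E) (φ.symm z) (φ.symm z') ≤ pathELength 𝓘(ℝ, E) γ 0 1 :=
    riemannianEDist_le_pathELength hγ (by simp [γ]) (by simp [γ]) zero_le_one
  refine hle.trans ?_
  rw [pathELength_eq_lintegral_mfderiv_Icc]
  refine (setLIntegral_mono' measurableSet_Icc (g := fun _ => ENNReal.ofReal M)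
    fun t ht => ?_).trans (by simp)
  obtain ⟨htar, hM⟩ := hseg _ (hmem t ht)
  have h1 : HasMFDerivAt 𝓘(ℝ, E) 𝓘(ℝ, E) φ.symm (z + t • (z' - z))
      (mfderiv 𝓘(ℝ, E) 𝓘(ℝ, E) φ.symm (z + t • (z' - z))) :=
    (mdifferentiableAt_symm_of_mem_maximalAtlas hφ htar).hasMFDerivAt
  have h2 : HasFDerivAt (fun t : ℝ => z + t • (z' - z))
      (ContinuousLinearMap.toSpanSingleton ℝ (z' - z)) t := by
    have := (((hasDerivAt_id t).smul_const (z' - z)).const_add z).hasFDerivAt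
    simpa using this
  have h3 := (h1.comp t h2.hasMFDerivAt).mfderiv
  change ENNReal.ofReal (N.toSeminorm (γ t) (mfderiv 𝓘(ℝ, ℝ) 𝓘(ℝ, E) γ t 1)) ≤ _
  refine ENNReal.ofReal_le_ofReal (le_trans (le_of_eq ?_) hM)
  rw [chartSeminorm_apply]
  change N.toSeminorm (γ t) _ = N.toSeminorm (γ t) _
  congr 1
  refine (DFunLike.congr_fun h3 (1 : ℝ)).trans ?_
  have h4 := DFunLike.congr_fun (chartDerivSymm_symm htar) (z' - z)
  refine Eq.trans ?_ h4.symm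
  change mfderiv 𝓘(ℝ, E) 𝓘(ℝ, E) φ.symm (z + t • (z' - z)) ((1 : ℝ) • (z' - z)) = _
  rw [one_smul]
  rfl

/-- The speed of a path. -/
noncomputable def speed (N : FinslerStructure E X) (γ : ℝ → X) (t : ℝ) : ℝ :=
  N.toSeminorm (γ t) (mfderiv 𝓘(ℝ, ℝ) 𝓘(ℝ, E) γ t (1 : ℝ))

theorem speed_nonneg (N : FinslerStructure E X) (γ : ℝ → X) (t : ℝ) : 0 ≤ N.speed γ t :=
  apply_nonneg _ _

theorem continuous_speed (N : FinslerStructure E X) {γ : ℝ → X}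
    (hγ : ContMDiff 𝓘(ℝ, ℝ) 𝓘(ℝ, E) 1 γ) : Continuous (N.speed γ) := by
  have h1 : Continuous fun t : ℝ => (⟨t, (1 : ℝ)⟩ : TangentBundle 𝓘(ℝ, ℝ) ℝ) :=
    (tangentBundleModelSpaceHomeomorph 𝓘(ℝ, ℝ)).symm.continuous.comp
      (continuous_id.prodMk continuous_const)
  exact N.continuous_norm.comp ((hγ.continuous_tangentMap le_rfl).comp h1)

/-- The almost minimizing path can be taken `C^1` on all of `ℝ`. Its speed is then continuous and
its length an ordinary integral. -/
theorem exists_path_of_edist_lt (N : FinslerStructure E X) {x y : X} {L : ℝ}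
    (h : N.edist x y < ENNReal.ofReal L) :
    ∃ γ : ℝ → X, ContMDiff 𝓘(ℝ, ℝ) 𝓘(ℝ, E) 1 γ ∧ γ 0 = x ∧ γ 1 = y ∧
      ∫ t in (0 : ℝ)..1, N.speed γ t < L := by
  let := N.tangentENorm
  have := N.tangentENormSMulClass
  have h' : riemannianEDist 𝓘(ℝ, E) x y < ENNReal.ofReal L := h
  obtain ⟨γ, h0, h1, hγ, hlen, -⟩ :=
    exists_lt_locally_constant_of_riemannianEDist_lt h' zero_lt_one
  refine ⟨γ, hγ, h0, h1, ?_⟩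
  have hc := N.continuous_speed hγ
  rw [pathELength_eq_lintegral_mfderiv_Icc] at hlen
  change ∫⁻ t in Icc 0 1, ENNReal.ofReal (N.speed γ t) < _ at hlen
  rw [← ofReal_integral_eq_lintegral_ofReal hc.continuousOn.integrableOn_Icc
    (.of_forall (N.speed_nonneg γ))] at hlen
  rw [intervalIntegral.integral_of_le zero_le_one, ← integral_Icc_eq_integral_Ioc]
  exact (ENNReal.ofReal_lt_ofReal_iff_of_nonneg (integral_nonneg (N.speed_nonneg γ))).1 hlen

/-- In a chart, the increment of a path is bounded by its length. -/
theorem seminorm_sub_le_mul_integral_speed (N : FinslerStructure E X)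
    {ψ : OpenPartialHomeomorph X E} (hψ : ψ ∈ IsManifold.maximalAtlas 𝓘(ℝ, E) 1 X) {γ : ℝ → X}
    (hγ : ContMDiff 𝓘(ℝ, ℝ) 𝓘(ℝ, E) 1 γ) {a b : ℝ} (hab : a ≤ b) {q : Seminorm ℝ E}
    (hq : Continuous q) {M : ℝ} (hM : ∀ τ ∈ Icc a b, γ τ ∈ ψ.source ∧
      ∀ v, q v ≤ M * N.chartSeminorm ψ (γ τ) v) :
    q (ψ (γ b) - ψ (γ a)) ≤ M * ∫ t in a..b, N.speed γ t := by
  have hc := N.continuous_speed hγ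
  have hderiv : ∀ τ ∈ Icc a b, HasDerivAt (fun t => ψ (γ t))
      (chartDeriv ψ (γ τ) (mfderiv 𝓘(ℝ, ℝ) 𝓘(ℝ, E) γ τ (1 : ℝ))) τ := by
    intro τ hτ
    have h1 : HasMFDerivAt 𝓘(ℝ, E) 𝓘(ℝ, E) ψ (γ τ) (chartDeriv ψ (γ τ)) :=
      (mdifferentiableAt_of_mem_maximalAtlas hψ (hM τ hτ).1).hasMFDerivAt
    have h2 := (hγ.mdifferentiable one_ne_zero τ).hasMFDerivAt
    have h3 : HasFDerivAt (fun t => ψ (γ t)) ((chartDeriv ψ (γ τ) : E →L[ℝ] E).comp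
        (mfderiv 𝓘(ℝ, ℝ) 𝓘(ℝ, E) γ τ : ℝ →L[ℝ] E)) τ := (h1.comp τ h2).hasFDerivAt
    exact h3.hasDerivAt
  -- `q` need not be differentiable, so right slopes are compared with the derivative of the length.
  refine image_le_of_liminf_slope_right_le_deriv_boundary
    (f := fun τ => q (ψ (γ τ) - ψ (γ a))) (B := fun τ => M * ∫ t in a..τ, N.speed γ t)
    (B' := fun τ => M * N.speed γ τ) ?_ (by simp) ?_ ?_ ?_ (right_mem_Icc.2 hab)
  · exact hq.comp_continuousOn (ContinuousOn.sub
      (fun τ hτ => (hderiv τ hτ).continuousAt.continuousWithinAt) continuousOn_const)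
  · exact ((intervalIntegral.continuous_primitive (fun _ _ => hc.intervalIntegrable _ _)
      a).const_mul M).continuousOn
  · intro τ _
    exact ((hc.integral_hasStrictDerivAt a τ).hasDerivAt.const_mul M).hasDerivWithinAt
  · intro τ hτ r hr
    have hτ' := Ico_subset_Icc_self hτ
    have hlt : q (chartDeriv ψ (γ τ) (mfderiv 𝓘(ℝ, ℝ) 𝓘(ℝ, E) γ τ (1 : ℝ))) < r := by
      refine ((hM τ hτ').2 _).trans_lt ?_
      rw [N.chartSeminorm_chartDeriv ⟨hψ, (hM τ hτ').1⟩]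
      exact hr
    have hs := (hderiv τ hτ').tendsto_slope.mono_left
      (nhdsWithin_mono τ fun t (ht : τ < t) => ne_of_gt ht)
    have hs' := (hq.tendsto _).comp hs
    refine Eventually.frequently ?_
    filter_upwards [hs'.eventually_lt_const hlt, self_mem_nhdsWithin] with t ht htτ
    have hpos : 0 < t - τ := sub_pos.2 htτ
    refine lt_of_le_of_lt ?_ ht
    simp only [Function.comp_apply, slope, vsub_eq_sub, smul_eq_mul]
    rw [map_smul_eq_mul, norm_inv, Real.norm_of_nonneg hpos.le]
    refine mul_le_mul_of_nonneg_left ?_ (inv_nonneg.2 hpos.le)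
    have := map_add_le_add q (ψ (γ t) - ψ (γ τ)) (ψ (γ τ) - ψ (γ a))
    rw [sub_add_sub_cancel] at this
    linarith

end FinslerStructure

end Length

/-! ### Descent for `f` in charts, path lifting and the theorem. -/

section Surjection

variable {E : Type*} [NormedAddCommGroup E] [NormedSpace ℝ E]
  {F : Type*} [NormedAddCommGroup F] [NormedSpace ℝ F]
  {X : Type*} [TopologicalSpace X] [ChartedSpace E X] [IsManifold 𝓘(ℝ, E) 1 X]
  {Y : Type*} [TopologicalSpace Y] [ChartedSpace F Y] [IsManifold 𝓘(ℝ, F) 1 Y]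

theorem FinslerStructure.exists_le_chartSeminorm_le (N : FinslerStructure E X) {x : X}
    {φ : OpenPartialHomeomorph X E} (h : IsChartAt φ x) :
    ∃ c > 0, ∃ C, ∀ v, c * ‖v‖ ≤ N.chartSeminorm φ x v ∧ N.chartSeminorm φ x v ≤ C * ‖v‖ := by
  obtain ⟨c, hc, C, -, hcC⟩ := N.equivalent x φ h
  exact ⟨c, hc, C, hcC⟩

theorem FinslerStructure.continuous_chartSeminorm (N : FinslerStructure E X) {x : X}
    {φ : OpenPartialHomeomorph X E} (h : IsChartAt φ x) : Continuous (N.chartSeminorm φ x) := by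
  obtain ⟨c, -, C, hcC⟩ := N.exists_le_chartSeminorm_le h
  exact Seminorm.continuous_of_le_mul_norm fun v => (hcC v).2

/-- The functional `l` competes in the infimum. Used contrapositively: a Banach constant above `β`
pushes `l ∘ T` out of the dual ball of radius `β`. -/
theorem banachConstant_transport_le {NX : FinslerStructure E X} {NY : FinslerStructure F Y}
    {f : X → Y} {x u : X} {φ : OpenPartialHomeomorph X E} {ψ : OpenPartialHomeomorph Y F}
    (h : IsChartPair f x φ ψ) {β : ℝ} (hβ : 0 ≤ β) {l : TangentSpace 𝓘(ℝ, F) (f x) →L[ℝ] ℝ}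
    (hl : NY.dualNorm (f x) l = 1)
    {T : TangentSpace 𝓘(ℝ, E) u →L[ℝ] TangentSpace 𝓘(ℝ, F) (f u)}
    (hT : ∀ v : E, |l (chartDerivSymm ψ (f x) (chartDeriv ψ (f u) (T (chartDerivSymm φ u v))))| ≤
      β * NX.chartSeminorm φ x v) :
    banachConstant NX NY x (f x) (transport f φ ψ x u T) ≤ ENNReal.ofReal β := by
  refine (iInf_le _ ⟨l, hl⟩).trans (NX.dualNorm_le hβ fun w => ?_)
  exact (hT (chartDeriv φ x w)).trans_eq
    (congrArg (β * ·) (NX.chartSeminorm_chartDeriv h.source w))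

/-- Where the Banach constants of the pseudo-Jacobian exceed `β`, the map read in charts approaches
every other value at rate `β`. -/
theorem frequently_decrease_of_lt_banachConstant {NX : FinslerStructure E X}
    {NY : FinslerStructure F Y} (hNY : NY.HasSmoothNorm) {f : X → Y}
    (hf : IsLocallyLipschitz E F f)
    {J : ∀ x : X, Set (TangentSpace 𝓘(ℝ, E) x →L[ℝ] TangentSpace 𝓘(ℝ, F) (f x))}
    (hJ : IsStrongPseudoJacobianMapping f J) {x u : X}
    {φ : OpenPartialHomeomorph X E} {ψ : OpenPartialHomeomorph Y F}
    (h : IsChartPair f x φ ψ) (hu : u ∈ φ.source) {β : ℝ} (hβ : 0 < β)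
    (hC : ∀ T ∈ J u, ENNReal.ofReal β < banachConstant NX NY x (f x) (transport f φ ψ x u T))
    {y : F} (hy : y ≠ inCharts f φ ψ (φ u)) :
    ∃ᶠ w in 𝓝[≠] (φ u), NY.chartSeminorm ψ (f x) (inCharts f φ ψ w - y) +
      β * NX.chartSeminorm φ x (w - φ u) ≤
        NY.chartSeminorm ψ (f x) (inCharts f φ ψ (φ u) - y) := by
  have hpu := h.of_mem hu
  obtain ⟨φ', ψ', JJ, hJJ, hconv⟩ := hJ u
  obtain ⟨hconv, hcomp⟩ := hconv (φ' u) (φ'.map_source hJJ.chartPair.source.2)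
  have hne : (JJ (φ' u)).Nonempty :=
    (hJJ.pseudoJacobian _ (φ'.map_source hJJ.chartPair.source.2)).1
  obtain ⟨l, hl1, hl⟩ := hNY.exists_hasFDerivAt h.target (sub_ne_zero.2 (Ne.symm hy))
  have hA := hJJ.hasDirectionalBound hf hpu
  have hAeq := hJJ.chartOperators_eq (φ := φ) (ψ := ψ)
  obtain ⟨K, s, hs, hKs⟩ := hf.exists_lipschitzOnWith hpu
  rw [hAeq] at hA
  refine HasDirectionalBound.frequently_decrease_of_isWOTCompact
    (NX.continuous_chartSeminorm h.source) hβ.le hne hconv hcomp hA hKs hs hl fun S hS hle => ?_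
  have hSA : ((chartDeriv ψ (f u)).comp (chartDerivSymm ψ' (f u)) : F →L[ℝ] F).comp
      (S.comp ((chartDeriv φ' u).comp (chartDerivSymm φ u) : E →L[ℝ] E)) ∈
        chartOperators f u φ ψ (J u) := by
    rw [hAeq]
    exact mem_image_of_mem _ hS
  obtain ⟨T, hT, hTS⟩ := hSA
  refine (hC T hT).not_ge (banachConstant_transport_le h hβ.le hl1 fun v => ?_)
  exact (congrArg (fun w => |l (chartDerivSymm ψ (f x) w)|) (DFunLike.congr_fun hTS v)).trans_le
    (hle v)

/-- Lifting of paths: if `f` approaches all values at rate `β` in a closed ball of a chart, then a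
`C^1` path can be lifted as long as its length allows. -/
theorem exists_eq_of_path [CompleteSpace E] [T2Space Y]
    (NX : FinslerStructure E X) (NY : FinslerStructure F Y) {f : X → Y} (hf : Continuous f) {x : X}
    {φ : OpenPartialHomeomorph X E} {ψ : OpenPartialHomeomorph Y F} (h : IsChartPair f x φ ψ)
    {β ε ρ L : ℝ} (hβ : 0 < β) (hε : 0 < ε) {U : Set Y} (hU : IsOpen U) (hUψ : U ⊆ ψ.source)
    (hUq : ∀ y ∈ U, ∀ v,
      NY.chartSeminorm ψ (f x) v ≤ (1 + ε) * NY.chartSeminorm ψ y v)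
    (hρ : ∀ z, NX.chartSeminorm φ x (z - φ x) ≤ ρ → z ∈ φ.target ∧ f (φ.symm z) ∈ U)
    (hdec : ∀ z, NX.chartSeminorm φ x (z - φ x) ≤ ρ → ∀ y, y ≠ inCharts f φ ψ z →
      ∃ᶠ w in 𝓝[≠] z, NY.chartSeminorm ψ (f x) (inCharts f φ ψ w - y) +
        β * NX.chartSeminorm φ x (w - z) ≤ NY.chartSeminorm ψ (f x) (inCharts f φ ψ z - y))
    {z₀ : E} (hz₀ : NX.chartSeminorm φ x (z₀ - φ x) ≤ ρ) {γ : ℝ → Y}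
    (hγ : ContMDiff 𝓘(ℝ, ℝ) 𝓘(ℝ, F) 1 γ) (hγ0 : γ 0 = f (φ.symm z₀))
    (hL : ∫ t in (0 : ℝ)..1, NY.speed γ t < L)
    (hint : ∀ z, NX.chartSeminorm φ x (z - φ x) ≤ ρ →
      NX.chartSeminorm φ x (z - z₀) < (1 + ε) / β * L → NX.chartSeminorm φ x (z - φ x) < ρ) :
    ∃ z, NX.chartSeminorm φ x (z - φ x) ≤ ρ ∧
      NX.chartSeminorm φ x (z - z₀) < (1 + ε) / β * L ∧ f (φ.symm z) = γ 1 := by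
  obtain ⟨c, hc, C, hcC⟩ := NX.exists_le_chartSeminorm_le h.source
  have hp := NX.continuous_chartSeminorm h.source
  have hq := NY.continuous_chartSeminorm h.target
  set p := NX.chartSeminorm φ x
  set q := NY.chartSeminorm ψ (f x)
  set κ := (1 + ε) / β with hκ
  have hκ0 : 0 < κ := by positivity
  let len : ℝ → ℝ := fun t => ∫ τ in (0 : ℝ)..t, NY.speed γ τ
  have hspeed := NY.continuous_speed hγ
  have hint' (a b : ℝ) : IntervalIntegrable (NY.speed γ) MeasureTheory.volume a b :=
    hspeed.intervalIntegrable _ _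
  have hlen : Continuous len := intervalIntegral.continuous_primitive hint' 0
  have hlen_sub (a b : ℝ) : len b - len a = ∫ τ in a..b, NY.speed γ τ :=
    intervalIntegral.integral_interval_sub_left (hint' _ _) (hint' _ _)
  have hlen_mono {a b : ℝ} (hab : a ≤ b) : len a ≤ len b := by
    have : 0 ≤ len b - len a := by
      rw [hlen_sub]
      exact intervalIntegral.integral_nonneg hab fun τ _ => NY.speed_nonneg γ τ
    linarith
  have hlen0 : len 0 = 0 := intervalIntegral.integral_same
  have hball : IsClosed {z : E | p (z - φ x) ≤ ρ} :=
    isClosed_le (hp.comp (continuous_id.sub continuous_const)) continuous_const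
  have hcont : ContinuousOn (fun z => f (φ.symm z)) {z : E | p (z - φ x) ≤ ρ} :=
    hf.comp_continuousOn (φ.continuousOn_symm.mono fun z hz => (hρ z hz).1)
  let D : Set (E × ℝ) := {z : E | p (z - φ x) ≤ ρ} ×ˢ Icc (0 : ℝ) 1
  -- Partial lifts: a point over each attained time. Closedness of `S` rests on `Y` being Hausdorff.
  let S : Set (E × ℝ) := D ∩ (fun s => (f (φ.symm s.1), γ s.2)) ⁻¹' diagonal Y
  have hS : IsClosed S :=
    ((hcont.comp continuousOn_fst fun s hs => hs.1).prodMk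
      (hγ.continuous.comp continuous_snd).continuousOn).preimage_isClosed_of_isClosed
      (hball.prod isClosed_Icc) isClosed_diagonal
  have hc' : 0 < min c 1 := lt_min hc one_pos
  -- The term `s.2` in the objective pays exactly for the time part of the distance when time
  -- increases. What remains is `p`-displacement at most `κ` times length, and advancing counts even
  -- where `γ` is stationary.
  obtain ⟨⟨z, t⟩, hzS, hz, hmax⟩ := exists_forall_add_le_imp_eq hS.isComplete
    (d := fun s s' => p (s'.1 - s.1) + |s'.2 - s.2|) (h := fun s => -(κ * len s.2 + s.2)) hc'
    (fun s s' => by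
      have h1 := (hcC (s'.1 - s.1)).1
      have h2 : min c 1 * ‖s'.1 - s.1‖ ≤ c * ‖s'.1 - s.1‖ :=
        mul_le_mul_of_nonneg_right (min_le_left _ _) (norm_nonneg _)
      have h3 : min c 1 * |s'.2 - s.2| ≤ 1 * |s'.2 - s.2| :=
        mul_le_mul_of_nonneg_right (min_le_right _ _) (abs_nonneg _)
      rw [dist_comm, Prod.dist_eq, dist_eq_norm, Real.dist_eq, mul_max_of_nonneg _ _ hc'.le]
      refine max_le ?_ ?_
      · linarith [abs_nonneg (s'.2 - s.2)]
      · linarith [apply_nonneg p (s'.1 - s.1)])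
    (fun s => by simp)
    (fun r s w => by
      have h1 := map_add_le_add p (w.1 - s.1) (s.1 - r.1)
      have h2 := abs_add_le (w.2 - s.2) (s.2 - r.2)
      rw [sub_add_sub_cancel] at h1 h2
      linarith)
    (fun s => (hp.comp (continuous_fst.sub continuous_const)).add
      (continuous_snd.sub continuous_const).abs)
    (((continuous_const.mul (hlen.comp continuous_snd)).add continuous_snd).neg.continuousOn)
    (m := -(κ * len 1 + 1))
    (fun s hs => by
      have := mul_le_mul_of_nonneg_left (hlen_mono hs.1.2.2) hκ0.le
      have := hs.1.2.2
      linarith)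
    (z₀ := (z₀, 0)) ⟨⟨hz₀, by simp⟩, hγ0.symm⟩
  obtain ⟨⟨hzρ, ht0, ht1⟩, hzγ⟩ := hzS
  change p (z - φ x) ≤ ρ at hzρ
  change f (φ.symm z) = γ t at hzγ
  dsimp only at hz ht0 ht1
  rw [hlen0, sub_zero, abs_of_nonneg ht0] at hz
  have hpz : p (z - z₀) < κ * L := by
    have h1 := mul_le_mul_of_nonneg_left (hlen_mono ht1) hκ0.le
    have h2 : κ * len 1 < κ * L := mul_lt_mul_of_pos_left hL hκ0
    linarith
  rcases ht1.eq_or_lt with rfl | ht1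
  · exact ⟨z, hzρ, hpz, hzγ⟩
  exfalso
  have hzlt := hint z hzρ hpz
  have hgz : inCharts f φ ψ z = ψ (γ t) := congrArg ψ hzγ
  set δ := ρ - p (z - φ x) with hδ
  have hδ0 : 0 < δ := sub_pos.2 hzlt
  have hsub : ∀ w, p (w - z) ≤ δ → p (w - φ x) ≤ ρ := fun w hw => by
    have := map_add_le_add p (w - z) (z - φ x)
    rw [sub_add_sub_cancel] at this
    linarith
  -- The path is not assumed to stay in `U`; it does so at lifted times because `f` maps the chart
  -- ball into `U`.
  have htU : γ t ∈ U := hzγ ▸ (hρ z hzρ).2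
  obtain ⟨η, hη, hηU⟩ := Metric.mem_nhds_iff.1
    (hγ.continuous.continuousAt.preimage_mem_nhds (hU.mem_nhds htU))
  have hψγ : ContinuousAt (fun τ => q (ψ (γ τ) - ψ (γ t))) t :=
    hq.continuousAt.comp ((((ψ.continuousAt (hUψ htU)).comp
      hγ.continuous.continuousAt)).sub continuousAt_const)
  have hev : ∀ᶠ τ in 𝓝[>] t, q (ψ (γ τ) - ψ (γ t)) < β * δ := by
    refine nhdsWithin_le_nhds (hψγ.eventually_lt_const ?_)
    simp only [sub_self, map_zero]
    positivity
  obtain ⟨τ, ⟨⟨hτδ, hτη⟩, hτ1⟩, hτt⟩ := (((hev.and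
    (nhdsWithin_le_nhds (Iio_mem_nhds (lt_add_of_pos_right t hη)))).and
    (nhdsWithin_le_nhds (Iio_mem_nhds ht1))).and self_mem_nhdsWithin).exists
  have hτU : ∀ s ∈ Icc t τ, γ s ∈ U := fun s hs => hηU (by
    rw [Metric.mem_ball, Real.dist_eq, abs_of_nonneg (sub_nonneg.2 hs.1)]
    linarith [hs.2])
  have hcont_g : ContinuousOn (inCharts f φ ψ) {w | p (w - z) ≤ δ} :=
    ψ.continuousOn.comp (hcont.mono fun w hw => hsub w hw)
      fun w hw => hUψ (hρ w (hsub w hw)).2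
  obtain ⟨w, hwle, hw⟩ := exists_eq_of_frequently_decrease hc (fun v => (hcC v).1)
    (fun v => (hcC v).2) hq hβ hcont_g (y := ψ (γ τ))
    (fun w hw hne => hdec w (hsub w hw.le) _ hne) (by rwa [hgz])
  have hlength : q (ψ (γ τ) - ψ (γ t)) ≤ (1 + ε) * ∫ s in t..τ, NY.speed γ s :=
    NY.seminorm_sub_le_mul_integral_speed h.target.1 hγ hτt.le hq
      fun s hs => ⟨hUψ (hτU s hs), hUq _ (hτU s hs)⟩
  rw [hgz] at hwle
  have hwδ : p (w - z) ≤ δ := hwle.trans (by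
    rw [div_le_iff₀ hβ, mul_comm]
    exact hτδ.le)
  have hwκ : p (w - z) ≤ κ * (len τ - len t) := by
    rw [hlen_sub, hκ, div_mul_eq_mul_div]
    exact hwle.trans (div_le_div_of_nonneg_right hlength hβ.le)
  have hfw : f (φ.symm w) = γ τ :=
    ψ.injOn (hUψ (hρ w (hsub w hwδ)).2) (hUψ (hτU τ ⟨hτt.le, le_rfl⟩)) hw
  -- The later pair `(w, τ)` satisfies the Ekeland inequality, so it would have to equal `(z, t)`.
  have := hmax (w, τ) ⟨⟨hsub w hwδ, (ht0.trans_lt hτt).le, hτ1.le⟩, hfw⟩ (by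
    dsimp only
    rw [abs_of_pos (sub_pos.2 hτt)]
    linarith)
  exact hτt.ne' (congrArg Prod.snd this)

end Surjection

theorem theorem4p6
    {E : Type*} [NormedAddCommGroup E] [NormedSpace ℝ E] [CompleteSpace E]
    {F : Type*} [NormedAddCommGroup F] [NormedSpace ℝ F] [CompleteSpace F]
    {X : Type*} [TopologicalSpace X] [T2Space X] [ConnectedSpace X]
    [ChartedSpace E X] [IsManifold 𝓘(ℝ, E) 1 X]
    {Y : Type*} [TopologicalSpace Y] [T2Space Y] [ConnectedSpace Y]
    [ChartedSpace F Y] [IsManifold 𝓘(ℝ, F) 1 Y]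
    (NX : FinslerStructure E X) (NY : FinslerStructure F Y) (hNY : NY.HasSmoothNorm)
    (f : X → Y) (hf : IsLocallyLipschitz E F f)
    (J : ∀ x : X, Set (TangentSpace 𝓘(ℝ, E) x →L[ℝ] TangentSpace 𝓘(ℝ, F) (f x)))
    (hJ : IsStrongPseudoJacobianMapping f J) (x : X)
    (φ : OpenPartialHomeomorph X E) (ψ : OpenPartialHomeomorph Y F)
    (hφψ : IsChartPair f x φ ψ) :
    finslerRegularityIndex NX NY f J φ ψ x ≤ rateOfSurjection NX NY f x := by
  refine ENNReal.le_of_forall_nnreal_lt fun α hα => ?_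
  rcases eq_or_ne α 0 with rfl | hα0
  · simp
  obtain ⟨R, hR⟩ := lt_iSup_iff.1 hα
  obtain ⟨hR0, hR⟩ := lt_iSup_iff.1 hR
  obtain ⟨β', hαβ', hβ'⟩ := ENNReal.lt_iff_exists_nnreal_btwn.1 hR
  have hα' : (0 : ℝ) < α := NNReal.coe_pos.2 (pos_iff_ne_zero.2 hα0)
  have hαβ : (α : ℝ) < β' := NNReal.coe_lt_coe.2 (ENNReal.coe_lt_coe.1 hαβ')
  set β : ℝ := (β' : ℝ)
  have hβ : 0 < β := hα'.trans hαβ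
  rw [← ENNReal.ofReal_coe_nnreal] at hβ' ⊢
  have hbanach : ∀ u ∈ NX.ball x R ∩ φ.source, ∀ T ∈ J u,
      ENNReal.ofReal β < banachConstant NX NY x (f x) (transport f φ ψ x u T) :=
    fun u hu T hT => hβ'.trans_le (iInf₂_le _ (subset_convexHull ℝ _
      (mem_iUnion₂.2 ⟨u, hu, mem_image_of_mem _ hT⟩)))
  -- One factor `1 + ε` for the norms of `X`, one for those of `Y`. For `ε ≤ 1` the square is at
  -- most `1 + 3ε`, whence the division by `3`.
  obtain ⟨ε, hε, hεαβ⟩ : ∃ ε : ℝ, 0 < ε ∧ (1 + ε) * (1 + ε) * α ≤ β := by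
    have h1 : 0 < β / α - 1 := by rw [sub_pos, one_lt_div hα']; exact hαβ
    refine ⟨min 1 ((β / α - 1) / 3), lt_min one_pos (by positivity), ?_⟩
    rw [← le_div_iff₀ hα']
    have h2 := min_le_left 1 ((β / α - 1) / 3)
    have h3 := min_le_right 1 ((β / α - 1) / 3)
    have h4 : 0 < min 1 ((β / α - 1) / 3) := lt_min one_pos (by positivity)
    nlinarith
  obtain ⟨c, hc, C, hcC⟩ := NX.exists_le_chartSeminorm_le hφψ.source
  have hp := NX.continuous_chartSeminorm hφψ.source
  obtain ⟨UX, hUXo, hxUX, -, hUX⟩ := NX.locally_comparable x φ hφψ.source ε hε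
  obtain ⟨UY, hUYo, hxUY, hUYs, hUY⟩ := NY.locally_comparable (f x) ψ hφψ.target ε hε
  have hfc := hf.continuous
  have hnhds : φ.target ∩ φ.symm ⁻¹' (UX ∩ f ⁻¹' UY) ∈ 𝓝 (φ x) := by
    refine inter_mem (φ.open_target.mem_nhds (φ.map_source hφψ.source.2))
      (φ.continuousAt_symm (φ.map_source hφψ.source.2) ?_)
    rw [φ.left_inv hφψ.source.2]
    exact (hUXo.inter (hUYo.preimage hfc)).mem_nhds ⟨hxUX, hxUY⟩
  obtain ⟨r₀, hr₀, hr₀s⟩ := Metric.mem_nhds_iff.1 hnhds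
  -- The first bound puts the `p`-ball of radius `ρ` inside the good neighbourhood, the second puts
  -- its image in `NX.ball x R`, where the Banach constants exceed `β`.
  obtain ⟨ρ, hρ0, hρr, hρR⟩ : ∃ ρ > 0, ρ < c * r₀ ∧ (1 + ε) * ρ < R := by
    have h1 : 0 < min (c * r₀) (R / (1 + ε)) := by positivity
    obtain ⟨ρ, hρ0, hρ⟩ := exists_between h1
    obtain ⟨h2, h3⟩ := lt_min_iff.1 hρ
    rw [lt_div_iff₀ (by positivity), mul_comm] at h3
    exact ⟨ρ, hρ0, h2, h3⟩
  have hgood : ∀ z, NX.chartSeminorm φ x (z - φ x) ≤ ρ →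
      z ∈ φ.target ∧ φ.symm z ∈ UX ∧ f (φ.symm z) ∈ UY := fun z hz => by
    obtain ⟨h1, h2, h3⟩ := hr₀s (show z ∈ Metric.ball (φ x) r₀ by
      rw [Metric.mem_ball, dist_eq_norm]
      exact lt_of_mul_lt_mul_left ((hcC _).1.trans_lt (hz.trans_lt hρr)) hc.le)
    exact ⟨h1, h2, h3⟩
  have hedist : ∀ z, NX.chartSeminorm φ x (z - φ x) ≤ ρ →
      ∀ z', NX.chartSeminorm φ x (z' - φ x) ≤ ρ → NX.edist (φ.symm z) (φ.symm z') ≤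
        ENNReal.ofReal ((1 + ε) * NX.chartSeminorm φ x (z' - z)) := by
    intro z hz z' hz'
    refine NX.edist_symm_le hφψ.source.1 fun w hw => ?_
    have hmem := (Seminorm.convex_closedBall (NX.chartSeminorm φ x) (φ x) ρ).segment_subset
      ((Seminorm.mem_closedBall _).2 hz) ((Seminorm.mem_closedBall _).2 hz') hw
    obtain ⟨h1, h2, -⟩ := hgood w ((Seminorm.mem_closedBall _).1 hmem)
    exact ⟨h1, (hUX _ h2 _).2⟩
  have hxρ : NX.chartSeminorm φ x (φ x - φ x) ≤ ρ := by simpa using hρ0.le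
  have hdec : ∀ z, NX.chartSeminorm φ x (z - φ x) ≤ ρ → ∀ y, y ≠ inCharts f φ ψ z →
      ∃ᶠ w in 𝓝[≠] z, NY.chartSeminorm ψ (f x) (inCharts f φ ψ w - y) +
        β * NX.chartSeminorm φ x (w - z) ≤
          NY.chartSeminorm ψ (f x) (inCharts f φ ψ z - y) := by
    intro z hz y hy
    have hzt := (hgood z hz).1
    have hball : φ.symm z ∈ NX.ball x R := by
      have h1 := hedist (φ x) hxρ z hz
      rw [φ.left_inv hφψ.source.2] at h1
      refine NX.mem_ball'.2 (h1.trans_lt ((ENNReal.ofReal_lt_ofReal_iff hR0).2 (lt_of_le_of_lt ?_ hρR)))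
      exact mul_le_mul_of_nonneg_left hz (by positivity)
    have := frequently_decrease_of_lt_banachConstant hNY hf hJ hφψ (φ.map_target hzt) hβ
      (hbanach _ ⟨hball, φ.map_target hzt⟩) (y := y) (by rwa [φ.right_inv hzt])
    rwa [φ.right_inv hzt] at this
  refine le_iSup₂_of_le (α : ℝ) ⟨hα', φ.source ∩ φ ⁻¹' {z | NX.chartSeminorm φ x (z - φ x) < ρ},
    ?_, ?_⟩ le_rfl
  · refine inter_mem (φ.open_source.mem_nhds hφψ.source.2)
      ((φ.continuousAt hφψ.source.2) (IsOpen.mem_nhds ?_ ?_))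
    · exact isOpen_lt (hp.comp (continuous_id.sub continuous_const)) continuous_const
    · simpa using hρ0
  rintro u ⟨hus, huρ⟩ r hr hball y hy
  change NX.chartSeminorm φ x (φ u - φ x) < ρ at huρ
  obtain ⟨γ, hγ, hγ0, hγ1, hL⟩ := NY.exists_path_of_edist_lt (NY.mem_ball'.1 hy)
  have hmem : ∀ z, NX.chartSeminorm φ x (z - φ x) ≤ ρ →
      NX.chartSeminorm φ x (z - φ u) < (1 + ε) / β * (α * r) → φ.symm z ∈ NX.ball u r := by
    intro z hz hlt
    have h1 := hedist (φ u) huρ.le z hz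
    rw [φ.left_inv hus] at h1
    refine NX.mem_ball'.2 (h1.trans_lt ((ENNReal.ofReal_lt_ofReal_iff hr).2 ?_))
    calc (1 + ε) * NX.chartSeminorm φ x (z - φ u) < (1 + ε) * ((1 + ε) / β * (α * r)) := by
          gcongr
      _ = ((1 + ε) * (1 + ε) * α) / β * r := by ring
      _ ≤ 1 * r := by
          gcongr
          rwa [div_le_one hβ]
      _ = r := one_mul r
  obtain ⟨z, hzρ, hz, hfz⟩ := exists_eq_of_path NX NY hfc hφψ hβ hε hUYo hUYs
    (fun y hy v => by
      have := (hUY y hy v).1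
      rwa [one_div, inv_mul_le_iff₀ (by positivity)] at this)
    (fun z hz => ⟨(hgood z hz).1, (hgood z hz).2.2⟩) hdec huρ.le hγ
    (by rw [φ.left_inv hus, hγ0]) hL
    -- The assumption that the ball of radius `r` at `u` lies in the chosen neighbourhood is what
    -- keeps lifts strictly inside the chart ball.
    (fun z hz hlt => by
      have := (hball (hmem z hz hlt)).2
      rwa [mem_preimage, φ.right_inv (hgood z hz).1] at this)
  exact ⟨φ.symm z, hmem z hzρ hz, hfz.trans hγ1⟩
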